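/- Let $PV$ and $Y$ be finite sets (pointer variables and universally quantified variables), let $\Pi = 2^{PV}\times (Y\cup\{-\})$, and let $\mathcal F$ be a formula lattice over a data domain $D$: a finite join-semilattice of pairwise inequivalent quantifier-free formulas over the atoms $d(y)$, $y\in Y$, whose order refines implication and whose bottom and top elements are the formulas $\mathit{false}$ and $\mathit{true}$. A word $u\in\Pi^*$ is proper if each $p\in PV$ and each $y\in Y$ occurs at exactly one position of $u$. A QDA is a finite Moore machine $(Q,q_0,\Pi,\delta,f)$ with $\delta\colon Q\times\Pi\to Q$ and $f\colon Q\to\mathcal F$ that outputs $\mathit{false}$ on every word that is not proper. A formula word is a pair $(u,\alpha)$ with $u$ proper and $\alpha\in\mathcal F$; it is accepted by a QDA if the output of the QDA on $u$ is $\alpha$. A language of formula words is QDA-acceptable if it is the set of formula words accepted by some QDA. A QDA for it is minimal if it has the least possible number of states. A teacher for a QDA-acceptable language $\mathcal L$ answers a membership query for $u\in\Pi^*$ with the output of $u$, that is, the formula $\alpha$ with $(u,\alpha)\in\mathcal L$ if $u$ is proper, and $\mathit{false}$ otherwise. It answers an equivalence query, in which a Moore machine over $\Pi$ with outputs in $\mathcal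 F$ is conjectured, with "yes" if the conjecture is a QDA for $\mathcal L$, and otherwise with some counterexample, a word in $\Pi^*$ on which the output of the conjecture differs from the output given by $\mathcal L$ (in the same sense as for membership queries). **Theorem.** Every QDA-acceptable language $\mathcal L$ of formula words has a minimal QDA $\mathcal A$, which is unique up to isomorphism. There are a learning algorithm (a deterministic program that may pose membership and equivalence queries) and a polynomial $p$ in two variables such that, for all $PV$, $Y$, $D$, $\mathcal F$ and $\mathcal L$ as above, every encoding of letters and formulas, and every teacher for $\mathcal L$, the algorithm, given the list of the letters of $\Pi$, halts with the minimal QDA for $\mathcal L$ (up to isomorphism) as its output after time at most $p(|\mathcal A|, m)$. Here $|\mathcal A|$ is the size of a description of $\mathcal A$ (the sum of the sizes of all its transitions, with their letters, and of the formulas at its states), and $m$ is the length of the longest counterexample that the teacher returned ($0$ if there was none). -/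

import Mathlib

namespace QDALearning

/-! ### Words, formula lattices and quantified data automata -/

/-- The alphabet `Π = 2^PV × (Y ∪ {-})`; `none` is the symbol `-`. -/
abbrev Letter (PV Y : Type*) := Finset PV × Option Y

/-- Symbolic words: words over `Π`, carrying no data values. -/
abbrev SymWord (PV Y : Type*) := List (Letter PV Y)

/-- Every pointer variable and every universally quantified variable occurs at precisely one
position of the word. -/
def IsProper {PV Y : Type*} (u : SymWord PV Y) : Prop :=
  (∀ p : PV, ∃! i : Fin u.length, p ∈ (u.get i).1) ∧
    ∀ y : Y, ∃! i : Fin u.length, (u.get i).2 = some y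

/-- A formula lattice over the data domain `D` (a structure for the signature `L` of the fixed
constants, functions and relations): a finite set of pairwise inequivalent quantifier-free formulas
over `d(y)`, `y ∈ Y` (the free variable `y` stands for `d(y)`), with a join-semilattice order that
refines implication and has the formulas `false` and `true` as its bottom and top elements. -/
structure FormulaLattice (L : FirstOrder.Language) (D : Type*) [L.Structure D] (Y : Type*) where
  /-- the finite set of formulas -/
  carrier : Finset (L.Formula Y)
  isQF : ∀ φ ∈ carrier, φ.IsQF
  /-- the order `⊑` and the least upper bounds `⊔` -/
  semilattice : SemilatticeSup {φ // φ ∈ carrier}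
  false_mem : ⊥ ∈ carrier
  true_mem : ⊤ ∈ carrier
  false_le : ∀ α : {φ // φ ∈ carrier}, semilattice.le ⟨⊥, false_mem⟩ α
  le_true : ∀ α : {φ // φ ∈ carrier}, semilattice.le α ⟨⊤, true_mem⟩
  imp_of_le : ∀ α β : {φ // φ ∈ carrier}, semilattice.le α β →
    ∀ r : Y → D, α.1.Realize r → β.1.Realize r
  eq_of_equiv : ∀ α β : {φ // φ ∈ carrier},
    (∀ r : Y → D, α.1.Realize r ↔ β.1.Realize r) → α = β

section Automata

variable {L : FirstOrder.Language} {D : Type*} [L.Structure D] {Y : Type*}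

/-- The formulas of the lattice, as a type. -/
abbrev FormulaLattice.Elem (F : FormulaLattice L D Y) : Type _ := {φ // φ ∈ F.carrier}

/-- The formula `false` of the lattice. -/
def FormulaLattice.falseElem (F : FormulaLattice L D Y) : F.Elem := ⟨⊥, F.false_mem⟩

variable (PV : Type*) (F : FormulaLattice L D Y)

/-- A quantified data automaton `(Q, q₀, Π, δ, f)`, as a tuple; `Q` is taken finite wherever it
matters. As a device that maps symbolic words to formulas it is a Moore machine. -/
structure QDA (Q : Type*) where
  /-- the initial state `q₀` -/
  start : Q
  /-- the transition function `δ` -/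
  step : Q → Letter PV Y → Q
  /-- the final-evaluation function `f` -/
  out : Q → F.Elem

/-- Formula words: a proper symbolic word together with a formula of the lattice. -/
abbrev FormulaWord := {w : SymWord PV Y × F.Elem // IsProper w.1}

variable {PV F} {Q : Type*}

/-- The formula at the state reached after reading `u`. -/
def QDA.output (A : QDA PV F Q) (u : SymWord PV Y) : F.Elem :=
  A.out (u.foldl A.step A.start)

/-- The language of formula words accepted by `A`. -/
def QDA.formulaLanguage (A : QDA PV F Q) : Set (FormulaWord PV F) :=
  {w | A.output w.1.1 = w.1.2}

/-- The standing assumption on QDAs: the automaton verifies the constraints on the numbers of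
occurrences of variables, that is, words violating them are mapped to `false`. -/
def QDA.VerifiesInput (A : QDA PV F Q) : Prop :=
  ∀ u : SymWord PV Y, ¬ IsProper u → A.output u = F.falseElem

/-- `A` is a QDA (it satisfies the standing assumption) for the language `𝓛` of formula words. -/
def QDA.Accepts (A : QDA PV F Q) (𝓛 : Set (FormulaWord PV F)) : Prop :=
  A.VerifiesInput ∧ A.formulaLanguage = 𝓛

variable (PV F) in
/-- `𝓛` is accepted by some QDA (with finitely many states). -/
def QDAAcceptable (𝓛 : Set (FormulaWord PV F)) : Prop :=
  ∃ (Q : Type) (_ : Finite Q) (A : QDA PV F Q), A.Accepts 𝓛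

/-- `A` is a minimal QDA for `𝓛`: it has finitely many states, accepts `𝓛`, and no QDA for `𝓛`
has fewer states. -/
def QDA.IsMinimalFor (A : QDA PV F Q) (𝓛 : Set (FormulaWord PV F)) : Prop :=
  Finite Q ∧ A.Accepts 𝓛 ∧
    ∀ (Q' : Type) [Finite Q'] (B : QDA PV F Q'), B.Accepts 𝓛 → Nat.card Q ≤ Nat.card Q'

/-- Isomorphism of QDAs. -/
def QDA.Isomorphic {Q' : Type*} (A : QDA PV F Q) (B : QDA PV F Q') : Prop :=
  ∃ e : Q ≃ Q', e A.start = B.start ∧ (∀ q a, e (A.step q a) = B.step (e q) a) ∧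
    ∀ q, A.out q = B.out (e q)

/-! ### The teacher -/

variable (PV F) in
/-- A conjecture of the learner: a Moore machine over `Π` with outputs in the lattice. It need not
satisfy the standing assumption on QDAs. -/
abbrev Conjecture := Σ n : ℕ, QDA PV F (Fin n)

/-- A teacher for the language `𝓛`. On a membership query for the symbolic word `u` it returns the
output of `u`: the formula `α` with `(u, α) ∈ 𝓛` if `u` is proper and `false` otherwise. On an
equivalence query it says yes (`none`) exactly if the conjecture is a QDA for `𝓛`, and otherwise
returns an arbitrary word on which the conjecture has a wrong output. The reply may depend
on the number `i` of equivalence queries posed before, so that the teacher need not be consistent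
in its choice of counterexamples. -/
structure Teacher (𝓛 : Set (FormulaWord PV F)) where
  mem : SymWord PV Y → F.Elem
  mem_proper : ∀ u (hu : IsProper u), (⟨(u, mem u), hu⟩ : FormulaWord PV F) ∈ 𝓛
  mem_improper : ∀ u, ¬ IsProper u → mem u = F.falseElem
  equiv : ℕ → Conjecture PV F → Option (SymWord PV Y)
  equiv_yes : ∀ i H, equiv i H = none ↔ H.2.Accepts 𝓛
  equiv_counterexample : ∀ i H w, equiv i H = some w → H.2.output w ≠ mem w

end Automata

/-! ### The machine model: while-programs over binary trees -/

/-- The data of programs: binary trees (S-expressions over one atom). -/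
inductive Val where
  | nil : Val
  | cons : Val → Val → Val
  deriving DecidableEq

/-- The number of nodes of a tree. -/
def Val.size : Val → ℕ
  | .nil => 1
  | .cons a b => a.size + b.size + 1

/-- Lists as trees. -/
def Val.ofList : List Val → Val
  | [] => .nil
  | a :: l => .cons a (Val.ofList l)

/-- Natural numbers in unary. -/
def Val.ofNat (n : ℕ) : Val := Val.ofList (List.replicate n .nil)

/-- Expressions; `var i` is the `i`-th program variable and `eq` tests trees for equality. -/
inductive Expr where
  | var : ℕ → Expr
  | nil : Expr
  | cons : Expr → Expr → Expr
  | hd : Expr → Expr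
  | tl : Expr → Expr
  | eq : Expr → Expr → Expr

/-- A store assigns a tree to every program variable. -/
abbrev Store := ℕ → Val

/-- The value of an expression. The truth value "false" is `nil`; everything else is "true". -/
def Expr.eval (s : Store) : Expr → Val
  | .var i => s i
  | .nil => .nil
  | .cons a b => .cons (a.eval s) (b.eval s)
  | .hd a => match a.eval s with
    | .nil => .nil
    | .cons x _ => x
  | .tl a => match a.eval s with
    | .nil => .nil
    | .cons _ y => y
  | .eq a b => if a.eval s = b.eval s then .cons .nil .nil else .nil

/-- The time for evaluating an expression: every subexpression is charged the size of its value
(there is no sharing and no unit-cost operation on large values). -/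
def Expr.cost (s : Store) : Expr → ℕ
  | .var i => (s i).size
  | .nil => 1
  | .cons a b => a.cost s + b.cost s + ((Expr.cons a b).eval s).size
  | .hd a => a.cost s + ((Expr.hd a).eval s).size
  | .tl a => a.cost s + ((Expr.tl a).eval s).size
  | .eq a b => a.cost s + b.cost s + ((Expr.eq a b).eval s).size

/-- Programs: while-programs with two query commands, which put the teacher's reply to the query
described by the expression into a program variable. -/
inductive Cmd where
  | skip : Cmd
  | assign : ℕ → Expr → Cmd
  | seq : Cmd → Cmd → Cmd
  | ite : Expr → Cmd → Cmd → Cmd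
  | loop : Expr → Cmd → Cmd
  | askMem : ℕ → Expr → Cmd
  | askEquiv : ℕ → Expr → Cmd

section Execution

variable {L : FirstOrder.Language} {D : Type*} [L.Structure D] {PV Y : Type*}
  {F : FormulaLattice L D Y}

variable (PV F) in
/-- A representation of letters and formulas by trees, with an enumeration of the alphabet. -/
structure Coding where
  letters : List (Letter PV Y)
  nodup : letters.Nodup
  complete : ∀ a, a ∈ letters
  letter : Letter PV Y → Val
  letter_injective : Function.Injective letter
  formula : F.Elem → Val
  formula_injective : Function.Injective formula

/-- The code of a symbolic word. -/
def Coding.word (c : Coding PV F) (u : SymWord PV Y) : Val :=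
  Val.ofList (u.map c.letter)

/-- The code of an automaton with states `0, …, n - 1`: the initial state, followed by the list of
all states, each with its formula and its list of pairs (letter, successor state). -/
def Coding.automaton (c : Coding PV F) (H : Conjecture PV F) : Val :=
  .cons (Val.ofNat H.2.start) (Val.ofList (List.ofFn fun q : Fin H.1 =>
    .cons (c.formula (H.2.out q)) (Val.ofList (c.letters.map fun a =>
      .cons (c.letter a) (Val.ofNat (H.2.step q a))))))

/-- The code of the reply to an equivalence query: `nil` for yes, and a pair with the
counterexample as its second component otherwise. -/
def Coding.reply (c : Coding PV F) : Option (SymWord PV Y) → Val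
  | none => .nil
  | some w => .cons .nil (c.word w)

/-- The size of an automaton: each state contributes the size of its formula, and each transition
contributes one for its target plus the size of its letter. -/
noncomputable def Coding.automatonSize (c : Coding PV F) {Q : Type*} [Fintype Q]
    (A : QDA PV F Q) : ℕ :=
  ∑ q : Q, ((c.formula (A.out q)).size + (c.letters.map fun a => (c.letter a).size + 1).sum)

/-- The state of a learning process: the store, the number of equivalence queries posed so far, and
the length of the longest counterexample returned so far (`0` if there was none). The last two
are not accessible to the program. -/
structure Config where
  store : Store
  asked : ℕ
  longest : ℕ

/-- Writing a value into a program variable. -/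
def Config.write (s : Config) (x : ℕ) (v : Val) : Config :=
  { s with store := Function.update s.store x v }

/-- The initial state: variable `0` holds the list of the letters of the alphabet. -/
def Coding.initial (c : Coding PV F) : Config where
  store := Function.update (fun _ => Val.nil) 0 (Val.ofList (c.letters.map c.letter))
  asked := 0
  longest := 0

/-- The reply to an equivalence query is written into variable `x` and recorded. -/
def Config.receive (s : Config) (c : Coding PV F) (x : ℕ) (r : Option (SymWord PV Y)) :
    Config where
  store := Function.update s.store x (c.reply r)
  asked := s.asked + 1
  longest := max s.longest (r.elim 0 List.length)

/-- `Exec c T P s s' t`: with the teacher `T` and the representation `c`, the program `P`, started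
in `s`, halts in `s'` after time `t`. A query is charged the sizes of the question and
of the reply. A query whose text is not the code of a word or an automaton has no reply, and
the program does not halt properly. As codes are injective, execution is deterministic. -/
inductive Exec (c : Coding PV F) {𝓛 : Set (FormulaWord PV F)} (T : Teacher 𝓛) :
    Cmd → Config → Config → ℕ → Prop
  | skip (s : Config) : Exec c T .skip s s 1
  | assign (s : Config) (x : ℕ) (e : Expr) :
      Exec c T (.assign x e) s (s.write x (e.eval s.store)) (1 + e.cost s.store)
  | seq {P₁ P₂ : Cmd} {s s₁ s₂ : Config} {t₁ t₂ : ℕ} :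
      Exec c T P₁ s s₁ t₁ → Exec c T P₂ s₁ s₂ t₂ → Exec c T (.seq P₁ P₂) s s₂ (t₁ + t₂)
  | ite_true {e : Expr} {P₁ P₂ : Cmd} {s s' : Config} {t : ℕ} :
      e.eval s.store ≠ .nil → Exec c T P₁ s s' t →
        Exec c T (.ite e P₁ P₂) s s' (1 + e.cost s.store + t)
  | ite_false {e : Expr} {P₁ P₂ : Cmd} {s s' : Config} {t : ℕ} :
      e.eval s.store = .nil → Exec c T P₂ s s' t →
        Exec c T (.ite e P₁ P₂) s s' (1 + e.cost s.store + t)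
  | loop_done {e : Expr} {P : Cmd} {s : Config} :
      e.eval s.store = .nil → Exec c T (.loop e P) s s (1 + e.cost s.store)
  | loop_step {e : Expr} {P : Cmd} {s s₁ s₂ : Config} {t₁ t₂ : ℕ} :
      e.eval s.store ≠ .nil → Exec c T P s s₁ t₁ → Exec c T (.loop e P) s₁ s₂ t₂ →
        Exec c T (.loop e P) s s₂ (1 + e.cost s.store + t₁ + t₂)
  | askMem {s : Config} {x : ℕ} {e : Expr} {u : SymWord PV Y} :
      e.eval s.store = c.word u →
        Exec c T (.askMem x e) s (s.write x (c.formula (T.mem u)))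
          (1 + e.cost s.store + (c.formula (T.mem u)).size)
  | askEquiv {s : Config} {x : ℕ} {e : Expr} {H : Conjecture PV F} :
      e.eval s.store = c.automaton H →
        Exec c T (.askEquiv x e) s (s.receive c x (T.equiv s.asked H))
          (1 + e.cost s.store + (c.reply (T.equiv s.asked H)).size)

end Execution

end QDALearning

namespace QDALearning

/-! ### Sizes of trees -/

/-! An acceptable language fixes the output on every word: the language does so on proper words, the
standing assumption on the others. So all its QDAs compute the same function
(`QDA.Accepts.output_eq`), and membership queries evaluate it (`QDA.Accepts.mem_eq`). The
Myhill–Nerode quotient is a reduced machine for this function (`exists_isReduced`). In a reduced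
machine the state reached by a word depends only on the state that any other acceptor reaches
(`QDA.IsReduced.run_eq`), which gives minimality and uniqueness.

The learner is Angluin's observation-table algorithm, in the variant that adds the suffixes of a
counterexample. It keeps a list `S` of access words and a list `E` of suffixes; the row of a word
consists of the outputs after appending each suffix. The rows of the access words are pairwise
different, so these words reach different states of every acceptor, and `S` has at most `n` elements
if there is an acceptor with `n` states (`length_le_of_nodup_rows`). If a one-letter extension of an
access word has a new row, it becomes an access word. Otherwise the table is closed and defines a
conjecture with state set `S` (`hypothesis`). The decisive fact is `not_closed_addSuffixes`: once
the suffixes of a counterexample are in `E`, the table is no longer closed. Hence a new access word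
follows each refuted conjecture, the number `k` of equivalence queries stays at most `S.length`, and
`S.length + k` grows in every round but never exceeds `2 * n` (`takes_learnLoop`). A conjecture that
is confirmed has at most `n` states, so it is minimal.

For the running time, all trees that occur have size polynomial in the automaton size and the
longest counterexample (`Inv.fits`). The subroutines are measured by the number of simple commands
on trees of size at most `B` (`Run`), and crude powers absorb all constants.

Access words are stored reversed and newest first, so that appending a letter and adding a word are
both `cons`. State `i` is the `i`-th word of `S.reverse`; state `0` is the empty word. -/

theorem Val.one_le_size (v : Val) : 1 ≤ v.size := by
  cases v <;> simp [Val.size]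

theorem Val.length_le_size_ofList (l : List Val) : l.length + 1 ≤ (Val.ofList l).size := by
  induction l with
  | nil => simp [Val.ofList, Val.size]
  | cons a l ih => simp only [Val.ofList, Val.size, List.length_cons]; omega

theorem Val.size_ofList_append (l₁ l₂ : List Val) :
    (Val.ofList (l₁ ++ l₂)).size + 1 = (Val.ofList l₁).size + (Val.ofList l₂).size := by
  induction l₁ with
  | nil => simp [Val.ofList, Val.size]; omega
  | cons a l ih => simp only [List.cons_append, Val.ofList, Val.size]; omega

theorem Val.size_ofList_reverse (l : List Val) :
    (Val.ofList l.reverse).size = (Val.ofList l).size := by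
  induction l with
  | nil => rfl
  | cons a l ih =>
    have := Val.size_ofList_append l.reverse [a]
    simp only [List.reverse_cons, Val.ofList, Val.size] at *; omega

theorem Val.size_ofList_le (l : List Val) (b : ℕ) (h : ∀ v ∈ l, v.size ≤ b) :
    (Val.ofList l).size ≤ 1 + l.length * (b + 1) := by
  induction l with
  | nil => simp [Val.ofList, Val.size]
  | cons a l ih =>
    have h1 := h a (by simp)
    have h2 := ih fun v hv => h v (by simp [hv])
    simp only [Val.ofList, Val.size, List.length_cons, Nat.add_mul]; omega

theorem Val.ofList_injective : Function.Injective Val.ofList := by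
  intro l₁
  induction l₁ with
  | nil => intro l₂ h; cases l₂ <;> simp_all [Val.ofList]
  | cons a l ih =>
    intro l₂ h
    cases l₂ with
    | nil => simp [Val.ofList] at h
    | cons b l₂ =>
      simp only [Val.ofList, Val.cons.injEq] at h
      rw [h.1, ih h.2]

theorem Val.size_ofNat (n : ℕ) : (Val.ofNat n).size = 2 * n + 1 := by
  induction n with
  | zero => rfl
  | succ n ih =>
    simp only [Val.ofNat, List.replicate_succ, Val.ofList, Val.size] at *; omega

/-! ### Costs of expressions -/

/-- All variables of the expression hold trees of size at most `B`. -/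
def Expr.Small (s : Store) (B : ℕ) : Expr → Prop
  | .var i => (s i).size ≤ B
  | .nil => True
  | .cons a b => a.Small s B ∧ b.Small s B
  | .hd a => a.Small s B
  | .tl a => a.Small s B
  | .eq a b => a.Small s B ∧ b.Small s B

/-- A bound for the size of the value, relative to the sizes of the variables. -/
def Expr.growth : Expr → ℕ
  | .var _ => 1
  | .nil => 1
  | .cons a b => a.growth + b.growth + 1
  | .hd a => a.growth
  | .tl a => a.growth
  | .eq _ _ => 3

/-- A bound for the cost, relative to the sizes of the variables. -/
def Expr.weight : Expr → ℕ
  | .var _ => 1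
  | .nil => 1
  | .cons a b => a.weight + b.weight + (a.growth + b.growth + 1)
  | .hd a => a.weight + a.growth
  | .tl a => a.weight + a.growth
  | .eq a b => a.weight + b.weight + 3

theorem Val.size_head_le (v : Val) :
    (match v with | .nil => Val.nil | .cons x _ => x).size ≤ v.size := by
  cases v <;> simp [Val.size]; omega

theorem Val.size_tail_le (v : Val) :
    (match v with | .nil => Val.nil | .cons _ y => y).size ≤ v.size := by
  cases v <;> simp [Val.size]; omega

theorem Expr.size_eval_le {s : Store} {B : ℕ} (hB : 1 ≤ B) (e : Expr) (h : e.Small s B) :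
    (e.eval s).size ≤ e.growth * B := by
  induction e with
  | var i => simpa [Expr.eval, Expr.growth, Expr.Small] using h
  | nil => simpa [Expr.eval, Expr.growth, Val.size] using hB
  | cons a b iha ihb =>
    have h1 := iha h.1
    have h2 := ihb h.2
    simp only [Expr.eval, Expr.growth, Val.size, Nat.add_mul]; omega
  | hd a ih => exact (Val.size_head_le _).trans (ih h)
  | tl a ih => exact (Val.size_tail_le _).trans (ih h)
  | eq a b iha ihb =>
    simp only [Expr.eval, Expr.growth]
    split_ifs <;> simp only [Val.size] <;> omega

theorem Expr.cost_le {s : Store} {B : ℕ} (hB : 1 ≤ B) (e : Expr) (h : e.Small s B) :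
    e.cost s ≤ e.weight * B := by
  induction e with
  | var i => simpa [Expr.cost, Expr.weight, Expr.Small] using h
  | nil => simpa [Expr.cost, Expr.weight] using hB
  | cons a b iha ihb =>
    have h1 := iha h.1
    have h2 := ihb h.2
    have h3 := Expr.size_eval_le hB (.cons a b) h
    simp only [Expr.cost, Expr.weight, Expr.growth, Nat.add_mul] at *; omega
  | hd a ih =>
    have h1 := ih h
    have h3 := Expr.size_eval_le hB (.hd a) h
    simp only [Expr.cost, Expr.weight, Expr.growth, Nat.add_mul] at *; omega
  | tl a ih =>
    have h1 := ih h
    have h3 := Expr.size_eval_le hB (.tl a) h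
    simp only [Expr.cost, Expr.weight, Expr.growth, Nat.add_mul] at *; omega
  | eq a b iha ihb =>
    have h1 := iha h.1
    have h2 := ihb h.2
    have h3 := Expr.size_eval_le hB (.eq a b) h
    simp only [Expr.cost, Expr.weight, Expr.growth, Nat.add_mul] at *; omega

/-- The unit `20 * B` pays for one simple command: at most `17 * B` for its expression, `2` for the
constant overhead, and `B` for the reply if it is a query. -/
theorem Expr.step_cost_le {s : Store} {B : ℕ} (hB : 1 ≤ B) (e : Expr) (h : e.Small s B)
    (hw : e.weight < 18) : 2 + e.cost s + B ≤ 20 * B := by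
  have h1 := Expr.cost_le hB e h
  have h2 : e.weight * B ≤ 17 * B := Nat.mul_le_mul_right _ (by omega)
  omega

/-! ### The memory of the learner -/

/-- The variables of the learning program. -/
structure Mem where
  /-- the letters, later the current conjecture -/
  out : Val := .nil
  /-- the reversed list of the letters -/
  sig : Val := .nil
  /-- the reversed access words -/
  acc : Val := .nil
  /-- the distinguishing suffixes -/
  suf : Val := .nil
  /-- the rows of the access words -/
  rows : Val := .nil
  /-- the states of the conjecture -/
  states : Val := .nil
  /-- a new access word, if one was found -/
  new : Val := .nil
  /-- the access words still to be treated -/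
  p : Val := .nil
  /-- the letters still to be treated -/
  q : Val := .nil
  /-- the transitions of the current state -/
  trans : Val := .nil
  /-- the reversed word whose row is computed -/
  u : Val := .nil
  /-- the row of `u` -/
  row : Val := .nil
  /-- the suffixes still to be treated -/
  e : Val := .nil
  /-- the word to be queried -/
  x : Val := .nil
  /-- the letters still to be put in front of `x` -/
  y : Val := .nil
  /-- the rows still to be compared with `row` -/
  t : Val := .nil
  /-- the number of rows compared with `row` -/
  i : Val := .nil
  /-- the counterexample -/
  w : Val := .nil
  /-- whether to continue -/
  go : Val := .nil

/-- The store with the given contents. -/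
def Mem.toStore (m : Mem) : Store
  | 0 => m.out
  | 1 => m.sig
  | 2 => m.acc
  | 3 => m.suf
  | 4 => m.rows
  | 5 => m.states
  | 6 => m.new
  | 7 => m.p
  | 8 => m.q
  | 9 => m.trans
  | 10 => m.u
  | 11 => m.row
  | 12 => m.e
  | 13 => m.x
  | 14 => m.y
  | 15 => m.t
  | 16 => m.i
  | 17 => m.w
  | 18 => m.go
  | _ => .nil

/-- Writing into a variable. -/
def Mem.set (m : Mem) : ℕ → Val → Mem
  | 0, v => { m with out := v }
  | 1, v => { m with sig := v }
  | 2, v => { m with acc := v }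
  | 3, v => { m with suf := v }
  | 4, v => { m with rows := v }
  | 5, v => { m with states := v }
  | 6, v => { m with new := v }
  | 7, v => { m with p := v }
  | 8, v => { m with q := v }
  | 9, v => { m with trans := v }
  | 10, v => { m with u := v }
  | 11, v => { m with row := v }
  | 12, v => { m with e := v }
  | 13, v => { m with x := v }
  | 14, v => { m with y := v }
  | 15, v => { m with t := v }
  | 16, v => { m with i := v }
  | 17, v => { m with w := v }
  | 18, v => { m with go := v }
  | _, _ => m

/-- Turns store updates into record updates. These compute, so the memory after a straight-line
piece of program can be identified by `rfl`. -/
theorem Mem.update_toStore (m : Mem) (x : ℕ) (v : Val) (hx : x < 19) :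
    Function.update m.toStore x v = (m.set x v).toStore := by
  funext j
  by_cases hj : j = x
  · subst hj
    rw [Function.update_self]
    interval_cases j <;> rfl
  · rw [Function.update_of_ne hj]
    by_cases h : j < 19
    · interval_cases x <;> interval_cases j <;> first | rfl | exact absurd rfl hj
    · obtain ⟨k, rfl⟩ := Nat.exists_eq_add_of_le (not_lt.1 h)
      have h1 : ∀ m' : Mem, m'.toStore (19 + k) = .nil := by
        intro m'
        rw [Nat.add_comm]
        rfl
      rw [h1, h1]

/-! ### Execution with bounded time -/

section Run

variable {L : FirstOrder.Language} {D : Type*} [L.Structure D] {PV Y : Type*}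
  {F : FormulaLattice L D Y} {𝓛 : Set (FormulaWord PV F)}

/-- The program `P` takes the memory from `m` to `m'` without equivalence queries and within `N`
units of time, where a unit suffices to execute a simple command on trees of size `B`. -/
def Run (c : Coding PV F) (T : Teacher 𝓛) (B : ℕ) (P : Cmd) (m m' : Mem) (N : ℕ) : Prop :=
  ∀ k l, ∃ t, Exec c T P ⟨m.toStore, k, l⟩ ⟨m'.toStore, k, l⟩ t ∧ t ≤ N * (20 * B)

variable {c : Coding PV F} {T : Teacher 𝓛} {B : ℕ}

theorem Run.mono {P : Cmd} {m m' : Mem} {N N' : ℕ} (h : Run c T B P m m' N) (hN : N ≤ N') :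
    Run c T B P m m' N' := by
  intro k l
  obtain ⟨t, h1, h2⟩ := h k l
  exact ⟨t, h1, h2.trans (Nat.mul_le_mul_right _ hN)⟩

theorem Run.skip (hB : 1 ≤ B) (m : Mem) : Run c T B .skip m m 1 :=
  fun _ _ => ⟨1, .skip _, by omega⟩

theorem Run.assign (hB : 1 ≤ B) {m m' : Mem} (x : ℕ) (e : Expr)
    (hs : e.Small m.toStore B) (hm : m.set x (e.eval m.toStore) = m')
    (hx : x < 19 := by decide) (hw : e.weight < 18 := by decide) :
    Run c T B (.assign x e) m m' 1 := by
  intro k l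
  have h := Exec.assign (c := c) (T := T) ⟨m.toStore, k, l⟩ x e
  rw [Config.write, Mem.update_toStore _ _ _ hx, hm] at h
  have := Expr.step_cost_le hB e hs hw
  exact ⟨_, h, by simp only; omega⟩

theorem Run.seq {P₁ P₂ : Cmd} {m m₁ m₂ : Mem} {N₁ N₂ : ℕ} (h₁ : Run c T B P₁ m m₁ N₁)
    (h₂ : Run c T B P₂ m₁ m₂ N₂) : Run c T B (.seq P₁ P₂) m m₂ (N₁ + N₂) := by
  intro k l
  obtain ⟨t₁, a₁, b₁⟩ := h₁ k l
  obtain ⟨t₂, a₂, b₂⟩ := h₂ k l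
  exact ⟨_, .seq a₁ a₂, by rw [Nat.add_mul]; omega⟩

theorem Run.assignSeq (hB : 1 ≤ B) {m m' : Mem} {x : ℕ} {e : Expr} {P : Cmd} {N : ℕ}
    (hs : e.Small m.toStore B) (h : Run c T B P (m.set x (e.eval m.toStore)) m' N)
    (hx : x < 19 := by decide) (hw : e.weight < 18 := by decide) :
    Run c T B (.seq (.assign x e) P) m m' (1 + N) :=
  (Run.assign hB x e hs rfl hx hw).seq h

theorem Run.ite_true (hB : 1 ≤ B) {e : Expr} {P₁ P₂ : Cmd} {m m' : Mem} {N : ℕ}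
    (he : e.eval m.toStore ≠ .nil) (hs : e.Small m.toStore B) (h : Run c T B P₁ m m' N)
    (hw : e.weight < 18 := by decide) :
    Run c T B (.ite e P₁ P₂) m m' (1 + N) := by
  intro k l
  obtain ⟨t, a, b⟩ := h k l
  have := Expr.step_cost_le hB e hs hw
  exact ⟨_, .ite_true he a, by rw [Nat.add_mul]; simp only; omega⟩

theorem Run.ite_false (hB : 1 ≤ B) {e : Expr} {P₁ P₂ : Cmd} {m m' : Mem} {N : ℕ}
    (he : e.eval m.toStore = .nil) (hs : e.Small m.toStore B) (h : Run c T B P₂ m m' N)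
    (hw : e.weight < 18 := by decide) :
    Run c T B (.ite e P₁ P₂) m m' (1 + N) := by
  intro k l
  obtain ⟨t, a, b⟩ := h k l
  have := Expr.step_cost_le hB e hs hw
  exact ⟨_, .ite_false he a, by rw [Nat.add_mul]; simp only; omega⟩

theorem Run.loop_done (hB : 1 ≤ B) {e : Expr} {P : Cmd} {m : Mem}
    (he : e.eval m.toStore = .nil) (hs : e.Small m.toStore B)
    (hw : e.weight < 18 := by decide) : Run c T B (.loop e P) m m 1 := by
  intro k l
  have := Expr.step_cost_le hB e hs hw
  exact ⟨_, .loop_done he, by simp only; omega⟩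

theorem Run.loop_step (hB : 1 ≤ B) {e : Expr} {P : Cmd} {m m₁ m₂ : Mem} {N₁ N₂ : ℕ}
    (he : e.eval m.toStore ≠ .nil) (hs : e.Small m.toStore B)
    (h₁ : Run c T B P m m₁ N₁) (h₂ : Run c T B (.loop e P) m₁ m₂ N₂)
    (hw : e.weight < 18 := by decide) : Run c T B (.loop e P) m m₂ (1 + N₁ + N₂) := by
  intro k l
  obtain ⟨t₁, a₁, b₁⟩ := h₁ k l
  obtain ⟨t₂, a₂, b₂⟩ := h₂ k l
  have := Expr.step_cost_le hB e hs hw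
  exact ⟨_, .loop_step he a₁ a₂, by rw [Nat.add_mul, Nat.add_mul]; simp only; omega⟩

theorem Run.askMem (hB : 1 ≤ B) {m m' : Mem} (x : ℕ) (e : Expr) (u : SymWord PV Y)
    (he : e.eval m.toStore = c.word u) (hs : e.Small m.toStore B)
    (hf : (c.formula (T.mem u)).size ≤ B)
    (hm : m.set x (c.formula (T.mem u)) = m')
    (hx : x < 19 := by decide) (hw : e.weight < 18 := by decide) :
    Run c T B (.askMem x e) m m' 1 := by
  intro k l
  have h := Exec.askMem (c := c) (T := T) (s := ⟨m.toStore, k, l⟩) (x := x) (e := e) he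
  rw [Config.write, Mem.update_toStore _ _ _ hx, hm] at h
  have := Expr.step_cost_le hB e hs hw
  exact ⟨_, h, by simp only; omega⟩

theorem Run.askMemSeq (hB : 1 ≤ B) {m m' : Mem} {x : ℕ} {e : Expr} {P : Cmd} {N : ℕ}
    (u : SymWord PV Y) (he : e.eval m.toStore = c.word u) (hs : e.Small m.toStore B)
    (hf : (c.formula (T.mem u)).size ≤ B)
    (h : Run c T B P (m.set x (c.formula (T.mem u))) m' N)
    (hx : x < 19 := by decide) (hw : e.weight < 18 := by decide) :
    Run c T B (.seq (.askMem x e) P) m m' (1 + N) :=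
  (Run.askMem hB x e u he hs hf rfl hx hw).seq h

end Run

/-! ### The subroutines of the learner -/

/-- Puts the letters of `y` in front of `x`, in reverse order. -/
def revLoop : Cmd :=
  .loop (.var 14) (.seq (.assign 13 (.cons (.hd (.var 14)) (.var 13))) (.assign 14 (.tl (.var 14))))

/-- Extends `row` by the replies to the queries for the remaining suffixes. -/
def rowLoop : Cmd :=
  .loop (.var 12) (.seq (.assign 13 (.hd (.var 12))) (.seq (.assign 14 (.var 10)) (.seq revLoop
    (.seq (.askMem 13 (.var 13)) (.seq (.assign 11 (.cons (.var 13) (.var 11)))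
      (.seq (.assign 13 .nil) (.assign 12 (.tl (.var 12)))))))))

/-- Computes the row of `u`. -/
def rowCmd : Cmd :=
  .seq (.assign 11 .nil) (.seq (.assign 12 (.var 3)) rowLoop)

/-- Searches for `row` in `t`. -/
def findLoop : Cmd :=
  .loop (.eq (.eq (.var 15) .nil) (.eq (.hd (.var 15)) (.var 11)))
    (.seq (.assign 15 (.tl (.var 15))) (.assign 16 (.cons .nil (.var 16))))

/-- Searches for `row` in `rows`. -/
def findCmd : Cmd :=
  .seq (.assign 15 (.var 4)) (.seq (.assign 16 .nil) findLoop)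

/-- Computes the transitions of the first state in `p` for the remaining letters. -/
def transLoop : Cmd :=
  .loop (.var 8) (.seq (.assign 10 (.cons (.hd (.var 8)) (.hd (.var 7)))) (.seq rowCmd (.seq findCmd
    (.seq (.assign 9 (.cons (.cons (.hd (.var 8)) (.var 16)) (.var 9)))
      (.seq (.ite (.var 15) .skip (.assign 6 (.var 10)))
        (.seq (.assign 10 .nil) (.seq (.assign 11 .nil) (.seq (.assign 15 .nil)
          (.seq (.assign 16 .nil) (.assign 8 (.tl (.var 8))))))))))))

/-- Computes the states for the remaining access words. -/
def statesLoop : Cmd :=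
  .loop (.var 7) (.seq (.assign 8 (.var 1)) (.seq transLoop (.seq (.assign 10 (.hd (.var 7)))
    (.seq rowCmd (.seq (.assign 5 (.cons (.cons (.hd (.var 11)) (.var 9)) (.var 5)))
      (.seq (.assign 9 .nil) (.seq (.assign 10 .nil) (.seq (.assign 11 .nil)
        (.assign 7 (.tl (.var 7)))))))))))

/-- Computes the rows of the remaining access words. -/
def rowsLoop : Cmd :=
  .loop (.var 7) (.seq (.assign 10 (.hd (.var 7))) (.seq rowCmd
    (.seq (.assign 4 (.cons (.var 11) (.var 4))) (.seq (.assign 10 .nil) (.seq (.assign 11 .nil)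
      (.assign 7 (.tl (.var 7))))))))

/-- Computes the rows and the states of the conjecture. -/
def tableCmd : Cmd :=
  .seq (.assign 4 .nil) (.seq (.assign 7 (.var 2)) (.seq rowsLoop
    (.seq (.assign 5 .nil) (.seq (.assign 6 .nil) (.seq (.assign 7 (.var 2)) statesLoop)))))

/-- Adds the nonempty suffixes of `w` to `suf`. -/
def sufLoop : Cmd :=
  .loop (.var 17) (.seq (.assign 3 (.cons (.var 17) (.var 3))) (.assign 17 (.tl (.var 17))))

/-! ### Correctness and running time of the subroutines -/

section

variable {L : FirstOrder.Language} {D : Type*} [L.Structure D] {PV Y : Type*}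
  {F : FormulaLattice L D Y} {𝓛 : Set (FormulaWord PV F)}

/-- The code of the row of the reversed word `u`: the outputs of the words `u.reverse ++ e` for the
suffixes `e`, the last suffix coming first. -/
def rowVal (c : Coding PV F) (T : Teacher 𝓛) (E : List (SymWord PV Y)) (u : SymWord PV Y) : Val :=
  .ofList ((E.map fun e => c.formula (T.mem (u.reverse ++ e))).reverse)

/-- The code of the transition from the state `s` with letter `a`. -/
def transVal (c : Coding PV F) (T : Teacher 𝓛) (E : List (SymWord PV Y)) (R : List Val)
    (s : SymWord PV Y) (a : Letter PV Y) : Val :=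
  .cons (c.letter a) (.ofNat (R.idxOf (rowVal c T E (a :: s))))

/-- The first component of a pair. -/
def Val.head : Val → Val
  | .nil => .nil
  | .cons a _ => a

/-- The code of the state `s`. -/
def stateVal (c : Coding PV F) (T : Teacher 𝓛) (E : List (SymWord PV Y)) (R : List Val)
    (s : SymWord PV Y) : Val :=
  .cons (rowVal c T E s).head (.ofList (c.letters.map (transVal c T E R s)))

variable {c : Coding PV F} {T : Teacher 𝓛} {B : ℕ}

/-- Moving a cell from one list to the other preserves the sum of the two sizes, so one bound on the
sum serves for the whole loop. -/
theorem run_revLoop (hB : 1 ≤ B) (m : Mem) (ys xs : List Val)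
    (h : (Val.ofList ys).size + (Val.ofList xs).size ≤ B) :
    Run c T B revLoop { m with y := .ofList ys, x := .ofList xs }
      { m with y := .nil, x := .ofList (ys.reverse ++ xs) } (3 * ys.length + 1) := by
  induction ys generalizing xs with
  | nil =>
    apply Run.mono
    · exact Run.loop_done hB rfl hB
    · simp
  | cons a ys ih =>
    have h1 : (Val.ofList (a :: ys)).size ≤ B := by omega
    have h2 : (Val.ofList xs).size ≤ B := by omega
    have h3 := ih (a :: xs) (by simp only [Val.ofList, Val.size] at *; omega)
    rw [List.reverse_cons, List.append_assoc, List.singleton_append]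
    apply Run.mono
    · exact Run.loop_step hB Val.noConfusion h1
        (Run.assignSeq hB (And.intro h1 h2) (Run.assign hB _ _ h1 rfl)) h3
    · simp only [List.length_cons]; omega

/-- A bound for the time that it takes to compute a row. -/
def rowTime (B : ℕ) : ℕ := B * (3 * B + 8) + 3

/-- As `u` is kept reversed, pushing its letters one by one onto a suffix `e` produces exactly the
query word `u.reverse ++ e`. -/
theorem run_rowLoop (hB : 1 ≤ B) (m : Mem) (u : SymWord PV Y) (es : List (SymWord PV Y))
    (acc : List Val) (he : (Val.ofList (es.map c.word)).size ≤ B)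
    (hu : (c.word u).size ≤ B)
    (hw : ∀ e ∈ es, (c.word u).size + (c.word e).size ≤ B)
    (hf : ∀ w, (c.formula (T.mem w)).size ≤ B)
    (hr : (Val.ofList ((es.map fun e => c.formula (T.mem (u.reverse ++ e))).reverse ++ acc)).size
      ≤ B) :
    Run c T B rowLoop
      { m with u := c.word u, e := .ofList (es.map c.word), row := .ofList acc, x := .nil,
               y := .nil }
      { m with u := c.word u, e := .nil, x := .nil, y := .nil,
               row := .ofList ((es.map fun e => c.formula (T.mem (u.reverse ++ e))).reverse ++ acc) }
      (es.length * (3 * u.length + 8) + 1) := by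
  induction es generalizing acc with
  | nil =>
    apply Run.mono
    · exact Run.loop_done hB rfl hB
    · simp
  | cons e es ih =>
    have hwe := hw e (by simp)
    have he' : (Val.ofList (es.map c.word)).size ≤ B := by
      simp only [List.map_cons, Val.ofList, Val.size] at *; omega
    simp only [List.map_cons, List.reverse_cons, List.append_assoc, List.cons_append,
      List.nil_append] at hr he ⊢
    have h3 := ih (c.formula (T.mem (u.reverse ++ e)) :: acc) he'
      (fun e' h' => hw e' (by simp [h'])) hr
    -- The current accumulator is a tail of the final row, so the bound for the final row covers it.
    have hacc : (Val.ofList (c.formula (T.mem (u.reverse ++ e)) :: acc)).size ≤ B := by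
      have := Val.size_ofList_append
        (es.map fun e => c.formula (T.mem (u.reverse ++ e))).reverse
        (c.formula (T.mem (u.reverse ++ e)) :: acc)
      have := Val.one_le_size
        (.ofList (es.map fun e => c.formula (T.mem (u.reverse ++ e))).reverse)
      omega
    have hacc' : (Val.ofList acc).size ≤ B := by
      simp only [Val.ofList, Val.size] at hacc; omega
    have hword : Val.ofList ((u.map c.letter).reverse ++ e.map c.letter) =
        c.word (u.reverse ++ e) := by simp [Coding.word]
    have hxs : (c.word (u.reverse ++ e)).size ≤ B := by
      rw [← hword]
      have := Val.size_ofList_append (u.map c.letter).reverse (e.map c.letter)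
      rw [Val.size_ofList_reverse] at this
      simp only [Coding.word] at *; omega
    have hrev := run_revLoop (c := c) (T := T) hB
      { m with u := c.word u, e := .ofList (c.word e :: es.map c.word), row := .ofList acc }
      (u.map c.letter) (e.map c.letter)
      (by simpa [Coding.word] using hwe)
    rw [hword] at hrev
    apply Run.mono
    · exact Run.loop_step hB Val.noConfusion he
        (Run.assignSeq hB he <| Run.assignSeq hB hu <| hrev.seq <|
          Run.askMemSeq hB (u.reverse ++ e) rfl hxs (hf _) <|
          Run.assignSeq hB (And.intro (hf _) hacc') <| Run.assignSeq hB trivial <|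
          Run.assign hB _ _ he rfl) h3
    · simp only [List.length_cons, List.length_map, Nat.add_mul]; omega

theorem run_rowCmd (hB : 1 ≤ B) (m : Mem) (u : SymWord PV Y) (E : List (SymWord PV Y))
    (he : (Val.ofList (E.map c.word)).size ≤ B)
    (hu : (c.word u).size ≤ B)
    (hw : ∀ e ∈ E, (c.word u).size + (c.word e).size ≤ B)
    (hf : ∀ w, (c.formula (T.mem w)).size ≤ B)
    (hr : (rowVal c T E u).size ≤ B) :
    Run c T B rowCmd
      { m with suf := .ofList (E.map c.word), u := c.word u, e := .nil, x := .nil, y := .nil }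
      { m with suf := .ofList (E.map c.word), u := c.word u, e := .nil, x := .nil, y := .nil,
               row := rowVal c T E u }
      (rowTime B) := by
  have h := run_rowLoop hB { m with suf := .ofList (E.map c.word) } u E [] he hu hw hf
    (by simpa [rowVal] using hr)
  rw [List.append_nil] at h
  refine Run.mono (Run.assignSeq hB trivial (Run.assignSeq hB he h)) ?_
  have h1 : E.length ≤ B := by
    have := Val.length_le_size_ofList (E.map c.word)
    rw [List.length_map] at this; omega
  have h2 : u.length ≤ B := by
    have := Val.length_le_size_ofList (u.map c.letter)
    simp only [Coding.word] at hu
    rw [List.length_map] at this; omega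
  have : E.length * (3 * u.length + 8) ≤ B * (3 * B + 8) := by gcongr
  unfold rowTime; omega

/-- The guard compares two truth values, "the list is empty" and "its head is `r`". They cannot both
be true, since the head of the empty list is `nil` and `r` is not. So they agree exactly if both are
false, that is, if the search must go on. -/
theorem run_findLoop (hB : 1 ≤ B) (m : Mem) (r : Val) (hr : r ≠ .nil) (ts : List Val) (j : ℕ)
    (hrB : r.size ≤ B) (ht : (Val.ofList ts).size ≤ B)
    (hj : (Val.ofNat (j + ts.length)).size ≤ B) :
    Run c T B findLoop
      { m with row := r, t := .ofList ts, i := .ofNat j }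
      { m with row := r, t := .ofList (ts.drop (ts.idxOf r)), i := .ofNat (j + ts.idxOf r) }
      (3 * ts.length + 1) := by
  induction ts generalizing j with
  | nil =>
    apply Run.mono
    · refine Run.loop_done hB ?_ (And.intro (And.intro ht trivial) (And.intro ht hrB))
      simp [Expr.eval, Mem.toStore, Val.ofList, hr.symm]
    · simp
  | cons a ts ih =>
    have ht' : (Val.ofList ts).size ≤ B := by simp only [Val.ofList, Val.size] at ht; omega
    have hj' : (Val.ofNat j).size ≤ B := by simp only [Val.size_ofNat] at *; omega
    by_cases ha : a = r
    · subst ha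
      simp only [List.idxOf_cons_self, List.drop_zero, Nat.add_zero]
      apply Run.mono
      · refine Run.loop_done hB ?_ (And.intro (And.intro ht trivial) (And.intro ht hrB))
        simp [Expr.eval, Mem.toStore, Val.ofList]
      · simp
    · rw [List.idxOf_cons_ne _ ha, List.drop_succ_cons]
      have h := ih (j + 1) ht' (by convert hj using 3; simp only [List.length_cons]; omega)
      rw [Nat.add_right_comm j 1] at h
      apply Run.mono
      · refine Run.loop_step hB ?_ (And.intro (And.intro ht trivial) (And.intro ht hrB))
          (Run.assignSeq hB ht (Run.assign hB _ _ (And.intro trivial hj') rfl)) h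
        simp [Expr.eval, Mem.toStore, Val.ofList, ha]
      · simp only [List.length_cons]; omega

theorem run_findCmd (hB : 1 ≤ B) (m : Mem) (r : Val) (hr : r ≠ .nil) (R : List Val)
    (hrB : r.size ≤ B) (hR : (Val.ofList R).size ≤ B) (hj : (Val.ofNat R.length).size ≤ B) :
    Run c T B findCmd
      { m with rows := .ofList R, row := r }
      { m with rows := .ofList R, row := r, t := .ofList (R.drop (R.idxOf r)),
               i := .ofNat (R.idxOf r) }
      (3 * B + 3) := by
  have h := run_findLoop (c := c) (T := T) hB { m with rows := .ofList R } r hr R 0 hrB hR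
    (by rwa [Nat.zero_add])
  rw [Nat.zero_add] at h
  refine Run.mono (Run.assignSeq hB hR (Run.assignSeq hB trivial h)) ?_
  have := Val.length_le_size_ofList R
  omega

/-- All trees that occur when the conjecture is computed have size at most `B`. -/
structure Fits (c : Coding PV F) (T : Teacher 𝓛) (B : ℕ) (S E : List (SymWord PV Y)) : Prop where
  letters : (Val.ofList (c.letters.map c.letter)).size ≤ B
  suf : (Val.ofList (E.map c.word)).size ≤ B
  acc : (Val.ofList (S.map c.word)).size ≤ B
  word : ∀ s ∈ S, ∀ a, ∀ e ∈ E, (c.word (a :: s)).size + (c.word e).size ≤ B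
  succ : ∀ s ∈ S, ∀ a, (c.word (a :: s)).size ≤ B
  formula : ∀ w, (c.formula (T.mem w)).size ≤ B
  row : ∀ u, (rowVal c T E u).size ≤ B
  rows : (Val.ofList (S.map (rowVal c T E)).reverse).size ≤ B
  length : (Val.ofNat S.length).size ≤ B
  states : (Val.ofList (S.map (stateVal c T E (S.map (rowVal c T E)).reverse)).reverse).size ≤ B

variable {S E : List (SymWord PV Y)}

theorem rowVal_ne_nil (hE : E ≠ []) (u : SymWord PV Y) : rowVal c T E u ≠ .nil := by
  intro h
  have : Val.ofList ((E.map fun e => c.formula (T.mem (u.reverse ++ e))).reverse) =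
    Val.ofList [] := h
  have := Val.ofList_injective this
  simp [hE] at this

theorem Fits.word' (h : Fits c T B S E) {s : SymWord PV Y} (hs : s ∈ S) {e : SymWord PV Y}
    (he : e ∈ E) : (c.word s).size + (c.word e).size ≤ B := by
  -- Any letter would do: dropping it from the extended word only decreases the size.
  have := h.word s hs (∅, none) e he
  simp only [Coding.word, List.map_cons, Val.ofList, Val.size] at *; omega

theorem Fits.acc' (h : Fits c T B S E) {s : SymWord PV Y} (hs : s ∈ S) :
    (c.word s).size ≤ B := by
  have := h.succ s hs (∅, none)
  simp only [Coding.word, List.map_cons, Val.ofList, Val.size] at *; omega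

/-- A bound for the time that it takes to compute a transition. -/
def transTime (B : ℕ) : ℕ := rowTime B + 3 * B + 15

/-- Besides the transitions, the loop leaves in `new` a witness against closedness if it meets one;
a later witness overwrites an earlier one. Clearing the scratch variables restores the shape of the
memory that the induction needs. -/
theorem run_transLoop (hB : 1 ≤ B) (hE : E ≠ []) (h : Fits c T B S E) (m : Mem)
    (s : SymWord PV Y) (hs : s ∈ S) (P : List Val) (as : List (Letter PV Y)) (acc : List Val)
    (nw : Val) (hP : (Val.ofList (c.word s :: P)).size ≤ B)
    (has : (Val.ofList (as.map c.letter)).size ≤ B)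
    (htr : (Val.ofList ((as.map (transVal c T E (S.map (rowVal c T E)).reverse s)).reverse ++
      acc)).size ≤ B) :
    ∃ nw', Run c T B transLoop
      { out := m.out, sig := m.sig, acc := m.acc, suf := .ofList (E.map c.word),
        rows := .ofList (S.map (rowVal c T E)).reverse, states := m.states, go := m.go,
        new := nw, p := .ofList (c.word s :: P), q := .ofList (as.map c.letter),
        trans := .ofList acc }
      { out := m.out, sig := m.sig, acc := m.acc, suf := .ofList (E.map c.word),
        rows := .ofList (S.map (rowVal c T E)).reverse, states := m.states, go := m.go,
        new := nw', p := .ofList (c.word s :: P), q := .nil,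
        trans := .ofList ((as.map (transVal c T E (S.map (rowVal c T E)).reverse s)).reverse ++
          acc) }
      (as.length * transTime B + 1) ∧
      (nw' = nw ∧ (∀ a ∈ as, rowVal c T E (a :: s) ∈ S.map (rowVal c T E)) ∨
        ∃ a ∈ as, nw' = c.word (a :: s) ∧ rowVal c T E (a :: s) ∉ S.map (rowVal c T E)) := by
  induction as generalizing acc nw with
  | nil =>
    refine ⟨nw, ?_, by simp⟩
    apply Run.mono
    · exact Run.loop_done hB rfl hB
    · simp
  | cons a as ih =>
    set R := (S.map (rowVal c T E)).reverse with hR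
    set r := rowVal c T E (a :: s) with hr
    have has' : (Val.ofList (as.map c.letter)).size ≤ B := by
      simp only [List.map_cons, Val.ofList, Val.size] at *; omega
    simp only [List.map_cons, List.reverse_cons, List.append_assoc, List.cons_append,
      List.nil_append] at htr has ⊢
    have hacc : (Val.ofList (transVal c T E R s a :: acc)).size ≤ B := by
      have := Val.size_ofList_append (as.map (transVal c T E R s)).reverse
        (transVal c T E R s a :: acc)
      have := Val.one_le_size (.ofList (as.map (transVal c T E R s)).reverse)
      omega
    have hacc' : (Val.ofList acc).size ≤ B := by
      simp only [Val.ofList, Val.size] at hacc; omega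
    have hi : (Val.ofNat (R.idxOf r)).size ≤ B := by
      simp only [Val.ofList, Val.size, transVal, ← hr] at hacc; omega
    have hu := h.succ s hs a
    have hdrop : (Val.ofList (R.drop (R.idxOf r))).size ≤ B := by
      have h1 := Val.size_ofList_append (R.take (R.idxOf r)) (R.drop (R.idxOf r))
      rw [List.take_append_drop] at h1
      have h2 := Val.one_le_size (.ofList (R.take (R.idxOf r)))
      have h3 := h.rows
      rw [← hR] at h3
      omega
    -- The search has stopped at the first occurrence of `r`, so the remaining list is nonempty
    -- exactly if `r` is the row of an access word.
    obtain ⟨nw₁, hite, hnw₁⟩ : ∃ nw₁,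
        Run c T B (.ite (.var 15) .skip (.assign 6 (.var 10)))
          { out := m.out, sig := m.sig, acc := m.acc, suf := .ofList (E.map c.word),
            rows := .ofList R, states := m.states, go := m.go,
            new := nw, p := .ofList (c.word s :: P), q := .ofList (c.letter a :: as.map c.letter),
            trans := .ofList (transVal c T E R s a :: acc), u := c.word (a :: s), row := r,
            t := .ofList (R.drop (R.idxOf r)), i := .ofNat (R.idxOf r) }
          { out := m.out, sig := m.sig, acc := m.acc, suf := .ofList (E.map c.word),
            rows := .ofList R, states := m.states, go := m.go,
            new := nw₁, p := .ofList (c.word s :: P), q := .ofList (c.letter a :: as.map c.letter),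
            trans := .ofList (transVal c T E R s a :: acc), u := c.word (a :: s), row := r,
            t := .ofList (R.drop (R.idxOf r)), i := .ofNat (R.idxOf r) } (1 + 1) ∧
          (nw₁ = nw ∧ r ∈ S.map (rowVal c T E) ∨
            nw₁ = c.word (a :: s) ∧ r ∉ S.map (rowVal c T E)) := by
      by_cases hmem : r ∈ S.map (rowVal c T E)
      · refine ⟨nw, ?_, .inl ⟨rfl, hmem⟩⟩
        refine Run.ite_true hB ?_ hdrop (Run.skip hB _)
        have : R.idxOf r < R.length := List.idxOf_lt_length_of_mem (by simpa [hR] using hmem)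
        intro h0
        have h0 : Val.ofList (R.drop (R.idxOf r)) = Val.ofList [] := h0
        have := Val.ofList_injective h0
        rw [List.drop_eq_nil_iff] at this
        omega
      · refine ⟨c.word (a :: s), ?_, .inr ⟨rfl, hmem⟩⟩
        refine Run.ite_false hB ?_ hdrop (Run.assign hB 6 _ hu rfl)
        have : R.idxOf r = R.length := List.idxOf_eq_length (by simpa [hR] using hmem)
        change Val.ofList (R.drop (R.idxOf r)) = .nil
        rw [this, List.drop_length]
        rfl
    obtain ⟨nw', hih, hnw'⟩ := ih (transVal c T E R s a :: acc) nw₁ has' htr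
    refine ⟨nw', ?_, ?_⟩
    · apply Run.mono
      · exact Run.loop_step hB Val.noConfusion has (Run.assignSeq hB (And.intro has hP) <| (run_rowCmd (u := a :: s) hB
          { out := m.out, sig := m.sig, acc := m.acc,
            rows := .ofList R, states := m.states, go := m.go,
            new := nw, p := .ofList (c.word s :: P), q := .ofList (c.letter a :: as.map c.letter),
            trans := .ofList acc } E h.suf hu (h.word s hs a) h.formula (h.row _)).seq <|
          (run_findCmd hB
          { out := m.out, sig := m.sig, acc := m.acc, suf := .ofList (E.map c.word),
            states := m.states, go := m.go,
            new := nw, p := .ofList (c.word s :: P), q := .ofList (c.letter a :: as.map c.letter),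
            trans := .ofList acc, u := c.word (a :: s) } r (rowVal_ne_nil hE _) R (h.row _) h.rows
            (by simpa [hR] using h.length)).seq <|
          Run.assignSeq hB (And.intro (And.intro has hi) hacc') <| hite.seq <|
          Run.assignSeq hB trivial <| Run.assignSeq hB trivial <|
          Run.assignSeq hB trivial <| Run.assignSeq hB trivial <| Run.assign hB _ _ has rfl) hih
      · simp only [List.length_cons, transTime, Nat.add_mul]; omega
    · rcases hnw' with ⟨rfl, h1⟩ | ⟨b, hb, h1, h2⟩
      · rcases hnw₁ with ⟨rfl, h2⟩ | ⟨rfl, h2⟩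
        · exact .inl ⟨rfl, List.forall_mem_cons.2 ⟨h2, h1⟩⟩
        · exact .inr ⟨a, by simp, rfl, h2⟩
      · exact .inr ⟨b, by simp [hb], h1, h2⟩

/-- A bound for the time that it takes to compute a state. -/
def stateTime (B : ℕ) : ℕ := B * transTime B + rowTime B + 10

theorem run_statesLoop (hB : 1 ≤ B) (hE : E ≠ []) (h : Fits c T B S E) (m : Mem)
    (ss : List (SymWord PV Y)) (hss : ∀ s ∈ ss, s ∈ S) (acc : List Val) (nw : Val)
    (hP : (Val.ofList (ss.map c.word)).size ≤ B)
    (hst : (Val.ofList ((ss.map (stateVal c T E (S.map (rowVal c T E)).reverse)).reverse ++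
      acc)).size ≤ B) :
    ∃ nw', Run c T B statesLoop
      { out := m.out, sig := .ofList (c.letters.map c.letter).reverse, acc := m.acc,
        suf := .ofList (E.map c.word),
        rows := .ofList (S.map (rowVal c T E)).reverse, states := .ofList acc, go := m.go,
        new := nw, p := .ofList (ss.map c.word) }
      { out := m.out, sig := .ofList (c.letters.map c.letter).reverse, acc := m.acc,
        suf := .ofList (E.map c.word),
        rows := .ofList (S.map (rowVal c T E)).reverse,
        states := .ofList ((ss.map (stateVal c T E (S.map (rowVal c T E)).reverse)).reverse ++
          acc), go := m.go, new := nw', p := .nil }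
      (ss.length * stateTime B + 1) ∧
      (nw' = nw ∧ (∀ s ∈ ss, ∀ a, rowVal c T E (a :: s) ∈ S.map (rowVal c T E)) ∨
        ∃ s ∈ ss, ∃ a, nw' = c.word (a :: s) ∧
          rowVal c T E (a :: s) ∉ S.map (rowVal c T E)) := by
  induction ss generalizing acc nw with
  | nil =>
    refine ⟨nw, ?_, by simp⟩
    apply Run.mono
    · exact Run.loop_done hB rfl hB
    · simp
  | cons s ss ih =>
    have hs : s ∈ S := hss s (by simp)
    set R := (S.map (rowVal c T E)).reverse with hR
    have hP' : (Val.ofList (ss.map c.word)).size ≤ B := by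
      simp only [List.map_cons, Val.ofList, Val.size] at *; omega
    simp only [List.map_cons, List.reverse_cons, List.append_assoc, List.cons_append,
      List.nil_append] at hst hP ⊢
    have hacc : (Val.ofList (stateVal c T E R s :: acc)).size ≤ B := by
      have := Val.size_ofList_append (ss.map (stateVal c T E R)).reverse
        (stateVal c T E R s :: acc)
      have := Val.one_le_size (.ofList (ss.map (stateVal c T E R)).reverse)
      omega
    have hacc' : (Val.ofList acc).size ≤ B := by
      simp only [Val.ofList, Val.size] at hacc; omega
    have htr : (Val.ofList (c.letters.map (transVal c T E R s))).size ≤ B := by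
      simp only [Val.ofList, Val.size, stateVal] at hacc; omega
    have hsig : (Val.ofList (c.letters.map c.letter).reverse).size ≤ B := by
      rw [Val.size_ofList_reverse]; exact h.letters
    have hlen : c.letters.length ≤ B := by
      have h1 := Val.length_le_size_ofList (c.letters.map c.letter)
      have h2 := h.letters
      rw [List.length_map] at h1; omega
    -- The letters are processed in reverse order, so that the accumulated transitions come out in
    -- the order of `c.letters`.
    obtain ⟨nw₁, htrans, hnw₁⟩ := run_transLoop hB hE h
      { out := m.out, sig := .ofList (c.letters.map c.letter).reverse, acc := m.acc,
        states := .ofList acc, go := m.go } s hs (ss.map c.word) c.letters.reverse [] nw hP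
      (by rwa [List.map_reverse])
      (by rwa [List.append_nil, List.map_reverse, List.reverse_reverse])
    rw [List.append_nil, List.map_reverse (f := transVal c T E _ s), List.reverse_reverse,
      List.map_reverse (f := c.letter)] at htrans
    obtain ⟨nw', hih, hnw'⟩ := ih (fun s hs => hss s (by simp [hs])) (stateVal c T E R s :: acc)
      nw₁ hP' hst
    refine ⟨nw', ?_, ?_⟩
    · apply Run.mono
      · exact Run.loop_step hB Val.noConfusion hP (Run.assignSeq hB hsig <| htrans.seq <|
          Run.assignSeq hB hP <| (run_rowCmd (u := s) hB
          { out := m.out, sig := .ofList (c.letters.map c.letter).reverse, acc := m.acc,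
            rows := .ofList R, states := .ofList acc, go := m.go,
            new := nw₁, p := .ofList (c.word s :: ss.map c.word),
            trans := .ofList (c.letters.map (transVal c T E R s)) } E h.suf (h.acc' hs)
              (fun e he => h.word' hs he) h.formula (h.row _)).seq <|
          Run.assignSeq hB (And.intro (And.intro (h.row s) htr) hacc') <|
          Run.assignSeq hB trivial <| Run.assignSeq hB trivial <| Run.assignSeq hB trivial <|
          Run.assign hB _ _ hP rfl) hih
      · have : c.letters.length * transTime B ≤ B * transTime B := by gcongr
        simp only [List.length_cons, List.length_reverse, stateTime, Nat.add_mul]; omega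
    · rcases hnw' with ⟨rfl, h1⟩ | ⟨b, hb, h1⟩
      · rcases hnw₁ with ⟨rfl, h2⟩ | ⟨a, -, rfl, h2⟩
        · refine .inl ⟨rfl, List.forall_mem_cons.2 ⟨fun a => h2 a ?_, h1⟩⟩
          simp [c.complete]
        · exact .inr ⟨s, by simp, a, rfl, h2⟩
      · exact .inr ⟨b, by simp [hb], h1⟩

theorem run_rowsLoop (hB : 1 ≤ B) (h : Fits c T B S E) (m : Mem)
    (ss : List (SymWord PV Y)) (hss : ∀ s ∈ ss, s ∈ S) (acc : List Val)
    (hP : (Val.ofList (ss.map c.word)).size ≤ B)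
    (hst : (Val.ofList ((ss.map (rowVal c T E)).reverse ++ acc)).size ≤ B) :
    Run c T B rowsLoop
      { out := m.out, sig := m.sig, acc := m.acc, suf := .ofList (E.map c.word),
        rows := .ofList acc, states := m.states, go := m.go,
        new := m.new, p := .ofList (ss.map c.word) }
      { out := m.out, sig := m.sig, acc := m.acc, suf := .ofList (E.map c.word),
        rows := .ofList ((ss.map (rowVal c T E)).reverse ++ acc), states := m.states, go := m.go,
        new := m.new, p := .nil }
      (ss.length * (rowTime B + 10) + 1) := by
  induction ss generalizing acc with
  | nil =>
    apply Run.mono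
    · exact Run.loop_done hB rfl hB
    · simp
  | cons s ss ih =>
    have hs : s ∈ S := hss s (by simp)
    have hP' : (Val.ofList (ss.map c.word)).size ≤ B := by
      simp only [List.map_cons, Val.ofList, Val.size] at *; omega
    simp only [List.map_cons, List.reverse_cons, List.append_assoc, List.cons_append,
      List.nil_append] at hst hP ⊢
    have hacc : (Val.ofList (rowVal c T E s :: acc)).size ≤ B := by
      have := Val.size_ofList_append (ss.map (rowVal c T E)).reverse (rowVal c T E s :: acc)
      have := Val.one_le_size (.ofList (ss.map (rowVal c T E)).reverse)
      omega
    have hacc' : (Val.ofList acc).size ≤ B := by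
      simp only [Val.ofList, Val.size] at hacc; omega
    have hih := ih (fun s hs => hss s (by simp [hs])) (rowVal c T E s :: acc) hP' hst
    apply Run.mono
    · exact Run.loop_step hB Val.noConfusion hP (
        Run.assignSeq hB hP <| (run_rowCmd (u := s) hB
        { out := m.out, sig := m.sig, acc := m.acc,
          rows := .ofList acc, states := m.states, go := m.go,
          new := m.new, p := .ofList (c.word s :: ss.map c.word) } E h.suf (h.acc' hs)
            (fun e he => h.word' hs he) h.formula (h.row _)).seq <|
        Run.assignSeq hB (And.intro (h.row s) hacc') <|
        Run.assignSeq hB trivial <| Run.assignSeq hB trivial <|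
        Run.assign hB _ _ hP rfl) hih
    · simp only [List.length_cons, Nat.add_mul]; omega

/-- A bound for the time that it takes to compute the conjecture. -/
def tableTime (B : ℕ) : ℕ := B * (rowTime B + 10) + B * stateTime B + 10

/-- A single pass both writes down the states and tests closedness. The states are a conjecture only
in the closed case; otherwise some transition has the invalid target `S.length`, and `new` holds a
word that must be added. -/
theorem run_tableCmd (hB : 1 ≤ B) (hE : E ≠ []) (h : Fits c T B S E) (m : Mem) :
    ∃ nw, Run c T B tableCmd
      { out := m.out, sig := .ofList (c.letters.map c.letter).reverse, acc := .ofList (S.map c.word),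
        suf := .ofList (E.map c.word), rows := m.rows, states := m.states, go := m.go,
        new := m.new }
      { out := m.out, sig := .ofList (c.letters.map c.letter).reverse, acc := .ofList (S.map c.word),
        suf := .ofList (E.map c.word),
        rows := .ofList (S.map (rowVal c T E)).reverse,
        states := .ofList (S.map (stateVal c T E (S.map (rowVal c T E)).reverse)).reverse,
        go := m.go, new := nw }
      (tableTime B) ∧
      (nw = .nil ∧ (∀ s ∈ S, ∀ a, rowVal c T E (a :: s) ∈ S.map (rowVal c T E)) ∨
        ∃ s ∈ S, ∃ a, nw = c.word (a :: s) ∧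
          rowVal c T E (a :: s) ∉ S.map (rowVal c T E)) := by
  have h1 := run_rowsLoop hB h
    { out := m.out, sig := .ofList (c.letters.map c.letter).reverse,
      acc := .ofList (S.map c.word), states := m.states, go := m.go, new := m.new } S
    (fun _ h => h) [] h.acc (by rw [List.append_nil]; exact h.rows)
  obtain ⟨nw, h2, h3⟩ := run_statesLoop hB hE h
    { out := m.out, acc := .ofList (S.map c.word), go := m.go } S (fun _ h => h) [] .nil h.acc (by rw [List.append_nil]; exact h.states)
  rw [List.append_nil] at h1 h2
  refine ⟨nw, ?_, h3⟩
  apply Run.mono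
  · exact Run.assignSeq hB trivial <| Run.assignSeq hB h.acc <| h1.seq <|
      Run.assignSeq hB trivial <| Run.assignSeq hB trivial <| Run.assignSeq hB h.acc h2
  · have hlen : S.length ≤ B := by
      have h1 := Val.length_le_size_ofList (S.map c.word)
      have h2 := h.acc
      rw [List.length_map] at h1; omega
    have : S.length * (rowTime B + 10) ≤ B * (rowTime B + 10) := by gcongr
    have : S.length * stateTime B ≤ B * stateTime B := by gcongr
    unfold tableTime; omega

/-- The nonempty suffixes of `w`, in front of the words in `E`. -/
def addSuffixes : SymWord PV Y → List (SymWord PV Y) → List (SymWord PV Y)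
  | [], E => E
  | a :: w, E => addSuffixes w ((a :: w) :: E)

theorem addSuffixes_eq (w : SymWord PV Y) (E : List (SymWord PV Y)) :
    addSuffixes w E = addSuffixes w [] ++ E := by
  induction w generalizing E with
  | nil => rfl
  | cons a w ih => rw [addSuffixes, addSuffixes, ih, ih [a :: w]]; simp

theorem run_sufLoop (hB : 1 ≤ B) (m : Mem) (w : SymWord PV Y) (E : List (SymWord PV Y))
    (hw : (c.word w).size ≤ B) (hE : (Val.ofList ((addSuffixes w E).map c.word)).size ≤ B) :
    Run c T B sufLoop
      { m with w := c.word w, suf := .ofList (E.map c.word) }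
      { m with w := .nil, suf := .ofList ((addSuffixes w E).map c.word) } (3 * B) := by
  have hlen : w.length < B := by
    have := Val.length_le_size_ofList (w.map c.letter)
    simp only [Coding.word] at hw
    rw [List.length_map] at this; omega
  suffices Run c T B sufLoop
      { m with w := c.word w, suf := .ofList (E.map c.word) }
      { m with w := .nil, suf := .ofList ((addSuffixes w E).map c.word) }
      (3 * w.length + 1) from this.mono (by omega)
  clear hlen
  induction w generalizing E with
  | nil =>
    apply Run.mono
    · exact Run.loop_done hB rfl hB
    · simp
  | cons a w ih =>
    have hE' : (Val.ofList (E.map c.word)).size ≤ B := by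
      rw [addSuffixes_eq, List.map_append] at hE
      have := Val.size_ofList_append ((addSuffixes (a :: w) []).map c.word) (E.map c.word)
      have := Val.one_le_size (.ofList ((addSuffixes (a :: w) []).map c.word))
      omega
    have hw' : (c.word w).size ≤ B := by
      simp only [Coding.word, List.map_cons, Val.ofList, Val.size] at *; omega
    apply Run.mono
    · exact Run.loop_step hB Val.noConfusion hw
        (Run.assignSeq hB (And.intro hw hE') (Run.assign hB _ _ hw rfl))
        (ih ((a :: w) :: E) hw' hE)
    · simp only [List.length_cons]; omega

end

/-! ### The minimal automaton -/

section Minimal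

variable {L : FirstOrder.Language} {D : Type*} [L.Structure D] {PV Y : Type*}
  {F : FormulaLattice L D Y} {𝓛 : Set (FormulaWord PV F)}

/-- The state reached after reading `u`. -/
def QDA.run {Q : Type*} (A : QDA PV F Q) (u : SymWord PV Y) : Q := u.foldl A.step A.start

theorem QDA.run_append {Q : Type*} (A : QDA PV F Q) (u v : SymWord PV Y) :
    A.run (u ++ v) = v.foldl A.step (A.run u) := List.foldl_append ..

theorem QDA.output_append {Q : Type*} (A : QDA PV F Q) (u v : SymWord PV Y) :
    A.output (u ++ v) = A.out (v.foldl A.step (A.run u)) :=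
  congrArg A.out (A.run_append u v)

theorem QDA.Accepts.output_eq {Q Q' : Type*} {A : QDA PV F Q} {B : QDA PV F Q'}
    (hA : A.Accepts 𝓛) (hB : B.Accepts 𝓛) (u : SymWord PV Y) : A.output u = B.output u := by
  by_cases hu : IsProper u
  · have h1 : (⟨(u, B.output u), hu⟩ : FormulaWord PV F) ∈ 𝓛 := by rw [← hB.2]; rfl
    rw [← hA.2] at h1
    exact h1
  · rw [hA.1 u hu, hB.1 u hu]

theorem QDA.Accepts.of_output_eq {Q Q' : Type*} {A : QDA PV F Q} {B : QDA PV F Q'}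
    (hA : A.Accepts 𝓛) (h : ∀ u, B.output u = A.output u) : B.Accepts 𝓛 := by
  refine ⟨fun u hu => by rw [h, hA.1 u hu], ?_⟩
  rw [← hA.2]
  ext w
  simp [QDA.formulaLanguage, h]

theorem QDA.Accepts.mem_eq {Q : Type*} {A : QDA PV F Q} (hA : A.Accepts 𝓛) (T : Teacher 𝓛)
    (u : SymWord PV Y) : T.mem u = A.output u := by
  by_cases hu : IsProper u
  · have h := T.mem_proper u hu
    exact ((Set.ext_iff.1 hA.2 _).2 h).symm
  · rw [T.mem_improper u hu, hA.1 u hu]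

/-- Every state is reachable, and words leading to distinct states are distinguished by some
suffix. -/
def QDA.IsReduced {Q : Type*} (A : QDA PV F Q) : Prop :=
  (∀ q, ∃ u, A.run u = q) ∧
    ∀ u v, (∀ e, A.output (u ++ e) = A.output (v ++ e)) → A.run u = A.run v

/-- Words that `B` does not separate have the same outputs under all continuations, and a reduced
machine merges such words. -/
theorem QDA.IsReduced.run_eq {Q Q' : Type*} {A : QDA PV F Q} {B : QDA PV F Q'}
    (hr : A.IsReduced) (hA : A.Accepts 𝓛) (hB : B.Accepts 𝓛) {u v : SymWord PV Y}
    (h : B.run u = B.run v) : A.run u = A.run v :=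
  hr.2 u v fun e => by
    rw [hA.output_eq hB, hA.output_eq hB, B.output_append, B.output_append, h]

theorem QDA.IsReduced.isMinimalFor {Q : Type*} [Finite Q] {A : QDA PV F Q} (hr : A.IsReduced)
    (hA : A.Accepts 𝓛) : A.IsMinimalFor 𝓛 := by
  refine ⟨inferInstance, hA, fun Q' _ B hB => ?_⟩
  choose w hw using hr.1
  refine Nat.card_le_card_of_injective (fun q => B.run (w q)) fun p q hpq => ?_
  rw [← hw p, ← hw q]
  exact hr.run_eq hA hB hpq

/-- Sending a state of `A` to the state of `B` reached by a representative word is injective by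
`QDA.IsReduced.run_eq`, hence bijective as both machines have the least number of states. -/
theorem QDA.IsReduced.isomorphic {Q : Type} [Finite Q] {Q' : Type} {A : QDA PV F Q}
    {B : QDA PV F Q'} (hr : A.IsReduced) (hA : A.Accepts 𝓛) (hB : B.IsMinimalFor 𝓛) :
    A.Isomorphic B := by
  obtain ⟨_, hB, hmin⟩ := hB
  have hcard : Nat.card Q = Nat.card Q' :=
    le_antisymm ((hr.isMinimalFor hA).2.2 Q' B hB) (hmin Q A hA)
  choose w hw using hr.1
  have hinj : Function.Injective fun q => B.run (w q) := fun p q hpq => by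
    rw [← hw p, ← hw q]
    exact hr.run_eq hA hB hpq
  have hbij : Function.Bijective fun q => B.run (w q) :=
    (Nat.bijective_iff_injective_and_card _).2 ⟨hinj, hcard⟩
  -- The bijection does not depend on the chosen representatives; compatibility with start,
  -- transitions and outputs follows from this.
  have key : ∀ u, B.run (w (A.run u)) = B.run u := by
    intro u
    obtain ⟨q, hq⟩ := hbij.2 (B.run u)
    have h := hr.run_eq hA hB hq
    rw [hw] at h
    rw [← h]
    exact hq
  refine ⟨Equiv.ofBijective _ hbij, key [], fun q a => ?_, fun q => ?_⟩
  · have h := key (w q ++ [a])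
    rw [A.run_append, B.run_append, hw] at h
    exact h
  · have h := hA.output_eq hB (w q)
    rw [← hw q]
    change A.output (w q) = B.out (B.run (w (A.run (w q))))
    rw [hw, h]
    rfl

/-- The states are the Myhill–Nerode classes: words with the same outputs under all continuations.
-/
theorem exists_isReduced (h : QDAAcceptable PV F 𝓛) :
    ∃ (n : ℕ) (A : QDA PV F (Fin n)), A.IsReduced ∧ A.Accepts 𝓛 := by
  obtain ⟨Q, _, A, hA⟩ := h
  let r : Setoid (SymWord PV Y) :=
    { r := fun u v => ∀ e, A.output (u ++ e) = A.output (v ++ e)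
      iseqv := ⟨fun _ _ => rfl, fun h e => (h e).symm, fun h h' e => (h e).trans (h' e)⟩ }
  -- Words that reach the same state of `A` are equivalent, so there are at most as many classes as
  -- states.
  have hfin : Finite (Quotient r) := by
    refine Finite.of_injective (fun q : Quotient r => A.run q.out) fun p q hpq => ?_
    rw [← p.out_eq, ← q.out_eq]
    refine Quotient.sound fun e => ?_
    rw [A.output_append, A.output_append]
    exact congrArg (fun q => A.out (e.foldl A.step q)) hpq
  let ε := Finite.equivFin (Quotient r)
  let B : QDA PV F (Fin (Nat.card (Quotient r))) :=
    { start := ε ⟦[]⟧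
      step := fun q a => ε (Quotient.map (fun u => u ++ [a])
        (fun u v (huv : ∀ e, _) e => by
          rw [List.append_assoc, List.append_assoc]; exact huv _) (ε.symm q))
      out := fun q => Quotient.lift A.output
        (fun u v (huv : ∀ e, _) => by simpa using huv []) (ε.symm q) }
  have hrun : ∀ u, B.run u = ε ⟦u⟧ := by
    intro u
    induction u using List.reverseRecOn with
    | nil => rfl
    | append_singleton u a ih =>
      rw [B.run_append, ih]
      simp [B]
  have hout : ∀ u, B.output u = A.output u := by
    intro u
    change B.out (B.run u) = _
    rw [hrun]
    simp [B]
  refine ⟨_, B, ⟨fun q => ⟨(ε.symm q).out, by rw [hrun]; simp⟩, fun u v huv => ?_⟩,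
    hA.of_output_eq hout⟩
  rw [hrun, hrun]
  refine congrArg ε (Quotient.sound fun e => ?_)
  rw [← hout, ← hout]
  exact huv e

end Minimal

/-! ### The conjectures of the learner -/

section Hypothesis

variable {L : FirstOrder.Language} {D : Type*} [L.Structure D] {PV Y : Type*}
  {F : FormulaLattice L D Y} {𝓛 : Set (FormulaWord PV F)}
  {c : Coding PV F} {T : Teacher 𝓛} {S E : List (SymWord PV Y)}

theorem rowVal_eq_iff {u v : SymWord PV Y} :
    rowVal c T E u = rowVal c T E v ↔
      ∀ e ∈ E, T.mem (u.reverse ++ e) = T.mem (v.reverse ++ e) := by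
  rw [rowVal, rowVal, Val.ofList_injective.eq_iff, List.reverse_inj, List.map_inj_left]
  simp only [c.formula_injective.eq_iff]

theorem mem_addSuffixes {w e : SymWord PV Y} :
    e ∈ addSuffixes w E ↔ (e ≠ [] ∧ e <:+ w) ∨ e ∈ E := by
  induction w generalizing E with
  | nil => simp [addSuffixes]
  | cons a w ih =>
    rw [addSuffixes, ih, List.mem_cons, List.suffix_cons_iff]
    constructor
    · rintro (h | rfl | h)
      · exact .inl ⟨h.1, .inr h.2⟩
      · exact .inl ⟨by simp, .inl rfl⟩
      · exact .inr h
    · rintro (⟨h, rfl | h'⟩ | h)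
      · exact .inr (.inl rfl)
      · exact .inl ⟨h, h'⟩
      · exact .inr (.inr h)

theorem length_addSuffixes (w : SymWord PV Y) :
    (addSuffixes w E).length = w.length + E.length := by
  induction w generalizing E with
  | nil => simp [addSuffixes]
  | cons a w ih => rw [addSuffixes, ih]; simp only [List.length_cons]; omega

/-- The successors of the access words have the rows of access words. -/
def Closed (c : Coding PV F) (T : Teacher 𝓛) (S E : List (SymWord PV Y)) : Prop :=
  ∀ s ∈ S, ∀ a, rowVal c T E (a :: s) ∈ S.map (rowVal c T E)

theorem Closed.idxOf_lt (h : Closed c T S E) (q : Fin S.length) (a : Letter PV Y) :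
    (S.map (rowVal c T E)).reverse.idxOf
      (rowVal c T E (a :: S.reverse[q.1]'(by simp))) < S.length := by
  have := List.idxOf_lt_length_of_mem (List.mem_reverse.2
    (h (S.reverse[q.1]'(by simp)) (List.mem_reverse.1 (List.getElem_mem _)) a))
  simpa using this

/-- The automaton with the access words as its states. -/
def hypothesis (hS : 0 < S.length) (h : Closed c T S E) : QDA PV F (Fin S.length) where
  start := ⟨0, hS⟩
  step q a := ⟨_, h.idxOf_lt q a⟩
  out q := T.mem (S.reverse[q.1]'(by simp)).reverse

theorem rowVal_step (hS : 0 < S.length) (h : Closed c T S E) (q : Fin S.length)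
    (a : Letter PV Y) :
    rowVal c T E (S.reverse[((hypothesis hS h).step q a).1]'(by simp)) =
      rowVal c T E (a :: S.reverse[q.1]'(by simp)) := by
  have h1 : (S.map (rowVal c T E)).reverse = S.reverse.map (rowVal c T E) := by simp
  have h2 := h.idxOf_lt q a
  have h3 := List.getElem_idxOf (xs := S.reverse.map (rowVal c T E))
    (x := rowVal c T E (a :: S.reverse[q.1]'(by simp))) (by
      rw [← h1]; exact h2.trans_eq (by simp))
  rw [List.getElem_map] at h3
  simp only [hypothesis, h1]
  exact h3

/-- The empty suffix is last in `E` and rows are written in reverse, so the head of a row is the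
output of the access word itself, as the code of a state requires. The leading `nil` is the initial
state `0`. -/
theorem automaton_hypothesis (hS : 0 < S.length) (h : Closed c T S E)
    (hE : ∃ E₀, E = E₀ ++ [[]]) :
    c.automaton ⟨S.length, hypothesis hS h⟩ =
      .cons .nil (.ofList (S.map (stateVal c T E (S.map (rowVal c T E)).reverse)).reverse) := by
  obtain ⟨E₀, rfl⟩ := hE
  simp only [Coding.automaton, Val.cons.injEq]
  refine ⟨rfl, congrArg _ ?_⟩
  refine List.ext_getElem (by simp) fun i h1 h2 => ?_
  rw [List.getElem_ofFn, List.getElem_reverse, List.getElem_map, stateVal]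
  congr 1
  · simp [rowVal, hypothesis, Val.ofList, Val.head]
  · simp only [hypothesis, List.getElem_reverse, List.length_map]
    rfl

/-- If the larger table were closed, each transition of the conjecture would preserve the true
output under every suffix of `w`. Following `w` from the empty access word, the conjecture would
then be right on `w`. -/
theorem not_closed_addSuffixes (hS : 0 < S.length) (h : Closed c T S E)
    (hS' : ∃ S₀, S = S₀ ++ [[]]) (hE : ∃ E₀, E = E₀ ++ [[]])
    (hnd : (S.map (rowVal c T E)).Nodup) {w : SymWord PV Y}
    (hw : (hypothesis hS h).output w ≠ T.mem w) : ¬ Closed c T S (addSuffixes w E) := by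
  intro hcl
  have hstep : ∀ (q : Fin S.length) (a : Letter PV Y) (x : SymWord PV Y), x <:+ w →
      T.mem ((S.reverse[((hypothesis hS h).step q a).1]'(by simp)).reverse ++ x) =
        T.mem ((S.reverse[q.1]'(by simp)).reverse ++ a :: x) := by
    intro q a x hx
    have hq : S.reverse[q.1]'(by simp) ∈ S := List.mem_reverse.1 (List.getElem_mem _)
    obtain ⟨s, hs, hs'⟩ := List.mem_map.1 (hcl _ hq a)
    have h1 := rowVal_eq_iff.1 hs'
    have h2 : rowVal c T E s = rowVal c T E (a :: S.reverse[q.1]'(by simp)) :=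
      rowVal_eq_iff.2 fun e he => h1 e (mem_addSuffixes.2 (.inr he))
    rw [← rowVal_step hS h q a] at h2
    -- The access word matching the extension on the larger table also matches it on `E`. As rows
    -- over `E` are distinct, it is the successor state chosen by the conjecture.
    have h3 := List.inj_on_of_nodup_map hnd hs (List.mem_reverse.1 (List.getElem_mem _)) h2
    rw [← h3, h1 x ?_]
    · simp
    · rw [mem_addSuffixes]
      by_cases hx0 : x = []
      · obtain ⟨E₀, rfl⟩ := hE
        exact .inr (by simp [hx0])
      · exact .inl ⟨hx0, hx⟩
  -- Induction on the part of `w` still to be read, for all states at once.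
  have key : ∀ (x : SymWord PV Y) (q : Fin S.length), x <:+ w →
      T.mem ((S.reverse[q.1]'(by simp)).reverse ++ x) =
        (hypothesis hS h).out (x.foldl (hypothesis hS h).step q) := by
    intro x
    induction x with
    | nil => intro q _; rw [List.append_nil]; rfl
    | cons a x ih =>
      intro q hx
      have hx' : x <:+ w := (List.suffix_cons a x).trans hx
      rw [← hstep q a x hx', ih _ hx', List.foldl_cons]
  have h0 := key w (hypothesis hS h).start List.suffix_rfl
  have h1 : S.reverse[((hypothesis hS h).start).1]'(by simp) = [] := by
    obtain ⟨S₀, rfl⟩ := hS'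
    simp [hypothesis]
  rw [h1] at h0
  exact hw h0.symm

/-- The row of a word is a function of the state that `A` reaches on it, so different rows need
different states. -/
theorem length_le_of_nodup_rows {n : ℕ} {A : QDA PV F (Fin n)} (hA : A.Accepts 𝓛)
    (hnd : (S.map (rowVal c T E)).Nodup) : S.length ≤ n := by
  have h1 : S.map (rowVal c T E) = (S.map fun s => A.run s.reverse).map fun q =>
      Val.ofList ((E.map fun e => c.formula (A.out (e.foldl A.step q))).reverse) := by
    rw [List.map_map]
    refine List.map_congr_left fun s _ => ?_
    simp only [rowVal, hA.mem_eq T, A.output_append, Function.comp]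
  rw [h1] at hnd
  simpa using hnd.of_map.length_le_card

/-- The invariant of the learner after `k` equivalence queries with counterexamples of length at
most `l`. -/
structure Inv (c : Coding PV F) (T : Teacher 𝓛) (S E : List (SymWord PV Y)) (k l : ℕ) :
    Prop where
  acc_last : ∃ S₀, S = S₀ ++ [[]]
  suf_last : ∃ E₀, E = E₀ ++ [[]]
  nodup : (S.map (rowVal c T E)).Nodup
  acc_length : ∀ s ∈ S, s.length ≤ S.length
  suf_length : ∀ e ∈ E, e.length ≤ l
  card : E.length ≤ 1 + k * l
  asked : k < S.length ∨ k ≤ S.length ∧ ¬ Closed c T S E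

theorem Inv.init : Inv c T [[]] [[]] 0 0 :=
  ⟨⟨[], rfl⟩, ⟨[], rfl⟩, by simp, by simp, by simp, by simp, by simp⟩

variable {k l : ℕ}

theorem Inv.length_pos (h : Inv c T S E k l) : 0 < S.length := by
  obtain ⟨S₀, rfl⟩ := h.acc_last
  simp

theorem Inv.asked_le (h : Inv c T S E k l) : k ≤ S.length := by
  rcases h.asked with h | h
  · exact h.le
  · exact h.1

theorem Inv.addAccess (h : Inv c T S E k l) {s : SymWord PV Y} {a : Letter PV Y} (hs : s ∈ S)
    (ha : rowVal c T E (a :: s) ∉ S.map (rowVal c T E)) : Inv c T ((a :: s) :: S) E k l where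
  acc_last := by
    obtain ⟨S₀, rfl⟩ := h.acc_last
    exact ⟨(a :: s) :: S₀, rfl⟩
  suf_last := h.suf_last
  nodup := List.nodup_cons.2 ⟨ha, h.nodup⟩
  acc_length := by
    refine List.forall_mem_cons.2 ⟨?_, fun t ht => ?_⟩
    · simpa using h.acc_length s hs
    · exact (h.acc_length t ht).trans (by simp)
  suf_length := h.suf_length
  card := h.card
  asked := .inl (by have := h.asked_le; simp only [List.length_cons]; omega)

/-- The table was closed when the query was posed, so `asked` gave the strict inequality. The query
uses up the slack, and the loss of closedness ensures that an access word is added before the next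
query. -/
theorem Inv.addSuffixes (h : Inv c T S E k l) (hcl : Closed c T S E) {w : SymWord PV Y}
    (hw : (hypothesis h.length_pos hcl).output w ≠ T.mem w) :
    Inv c T S (addSuffixes w E) (k + 1) (max l w.length) where
  acc_last := h.acc_last
  suf_last := by
    obtain ⟨E₀, hE₀⟩ := h.suf_last
    rw [addSuffixes_eq, hE₀]
    exact ⟨_, (List.append_assoc ..).symm⟩
  nodup := by
    refine List.Nodup.map_on (fun s hs t ht hst => ?_) h.nodup.of_map
    refine List.inj_on_of_nodup_map h.nodup hs ht (rowVal_eq_iff.2 fun e he => ?_)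
    exact rowVal_eq_iff.1 hst e (mem_addSuffixes.2 (.inr he))
  acc_length := h.acc_length
  suf_length := by
    intro e he
    rcases mem_addSuffixes.1 he with ⟨-, he⟩ | he
    · exact he.length_le.trans (le_max_right _ _)
    · exact (h.suf_length e he).trans (le_max_left _ _)
  card := by
    have h1 := h.card
    have h2 : k * l ≤ k * max l w.length := Nat.mul_le_mul_left _ (le_max_left _ _)
    have h3 := le_max_right l w.length
    rw [length_addSuffixes, Nat.add_mul]
    omega
  asked := by
    refine .inr ⟨?_, not_closed_addSuffixes h.length_pos hcl h.acc_last h.suf_last h.nodup hw⟩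
    rcases h.asked with h | h
    · exact h
    · exact absurd hcl h.2

end Hypothesis

/-! ### Polynomial bounds -/

theorem hundred_mul_pow_le {B : ℕ} (hB : 100 ≤ B) (k : ℕ) : 100 * B ^ k ≤ B ^ (k + 1) := by
  rw [pow_succ']
  gcongr

theorem tableTime_le {B : ℕ} (hB : 100 ≤ B) : tableTime B ≤ B ^ 5 := by
  have h0 : 100 * B ≤ B ^ 2 := by simpa using hundred_mul_pow_le hB 1
  have h2 : 100 * B ^ 2 ≤ B ^ 3 := hundred_mul_pow_le hB 2
  have h3 : 100 * B ^ 3 ≤ B ^ 4 := hundred_mul_pow_le hB 3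
  have h4 : 100 * B ^ 4 ≤ B ^ 5 := hundred_mul_pow_le hB 4
  have e : tableTime B = 3 * B ^ 4 + 17 * B ^ 3 + 34 * B ^ 2 + 26 * B + 10 := by
    simp only [tableTime, stateTime, transTime, rowTime]
    ring
  omega

theorem Val.size_ofList_eq (l : List Val) :
    (Val.ofList l).size = 1 + (l.map fun v => v.size + 1).sum := by
  induction l with
  | nil => rfl
  | cons a l ih => simp only [Val.ofList, Val.size, List.map_cons, List.sum_cons, ih]; omega

/-- The size is at most `1 + X ^ a * (X ^ b + 1)`, hence at most `3 * X ^ (a + b)`; the additional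
factor `X` absorbs the `3`. -/
theorem Val.size_ofList_le_pow {X a b : ℕ} (hX : 3 ≤ X) (l : List Val) (hl : l.length ≤ X ^ a)
    (hv : ∀ v ∈ l, v.size ≤ X ^ b) : (Val.ofList l).size ≤ X ^ (a + b + 1) := by
  have h1 := Val.size_ofList_le l _ hv
  have h2 : l.length * (X ^ b + 1) ≤ X ^ a * (X ^ b + 1) := by gcongr
  have h3 : X ^ a * 1 ≤ X ^ a * X ^ b := by gcongr; exact Nat.one_le_pow _ _ (by omega)
  have h4 : 1 ≤ X ^ a := Nat.one_le_pow _ _ (by omega)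
  have h5 : X ^ a * X ^ b * 3 ≤ X ^ a * X ^ b * X := by gcongr
  rw [pow_succ, pow_add]
  rw [Nat.mul_add (X ^ a)] at h2
  omega

/-! ### Sizes and times in terms of the automaton and the longest counterexample -/

section

variable {L : FirstOrder.Language} {D : Type*} [L.Structure D] {PV Y : Type*}
  {F : FormulaLattice L D Y} {𝓛 : Set (FormulaWord PV F)}
  {c : Coding PV F} {T : Teacher 𝓛} {S E : List (SymWord PV Y)} {n k l : ℕ}
  {A : QDA PV F (Fin n)}

theorem size_formula_le_automatonSize (c : Coding PV F) (q : Fin n) :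
    (c.formula (A.out q)).size ≤ c.automatonSize A :=
  (Nat.le_add_right _ _).trans (Finset.single_le_sum (f := fun q : Fin n =>
    (c.formula (A.out q)).size + (c.letters.map fun a => (c.letter a).size + 1).sum)
    (fun _ _ => Nat.zero_le _) (Finset.mem_univ q))

/-- One state already lists all letters, and the start state shows that there is one. -/
theorem sum_letters_le_automatonSize (c : Coding PV F) (A : QDA PV F (Fin n)) :
    (c.letters.map fun a => (c.letter a).size + 1).sum ≤ c.automatonSize A :=
  (Nat.le_add_left _ _).trans (Finset.single_le_sum (f := fun q : Fin n =>
    (c.formula (A.out q)).size + (c.letters.map fun a => (c.letter a).size + 1).sum)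
    (fun _ _ => Nat.zero_le _) (Finset.mem_univ A.start))

theorem card_le_automatonSize (c : Coding PV F) (A : QDA PV F (Fin n)) :
    n ≤ c.automatonSize A := by
  have : ∑ _q : Fin n, 1 ≤ c.automatonSize A :=
    Finset.sum_le_sum fun q _ => (Val.one_le_size _).trans (Nat.le_add_right _ _)
  simpa using this

theorem Fits.mono {B B' : ℕ} (h : Fits c T B S E) (hB : B ≤ B') : Fits c T B' S E where
  letters := h.letters.trans hB
  suf := h.suf.trans hB
  acc := h.acc.trans hB
  word s hs a e he := (h.word s hs a e he).trans hB
  succ s hs a := (h.succ s hs a).trans hB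
  formula w := (h.formula w).trans hB
  row u := (h.row u).trans hB
  rows := h.rows.trans hB
  length := h.length.trans hB
  states := h.states.trans hB

theorem size_word_le {X : ℕ} (hX : c.automatonSize A + 10 ≤ X) (u : SymWord PV Y)
    (hu : u.length ≤ X) : (c.word u).size ≤ X ^ 3 := by
  refine Val.size_ofList_le_pow (a := 1) (b := 1) (by omega) _ (by simpa using hu) ?_
  intro v hv
  obtain ⟨a, -, rfl⟩ := List.mem_map.1 hv
  have h1 : (c.letter a).size + 1 ≤ (c.letters.map fun a => (c.letter a).size + 1).sum :=
    List.le_sum_of_mem (List.mem_map_of_mem (f := fun a => (c.letter a).size + 1) (c.complete a))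
  have h2 := sum_letters_le_automatonSize c A
  rw [pow_one]
  omega

/-- There are at most `X` access words and, by `card` and `k ≤ S.length`, at most `X ^ 2` suffixes,
all of length at most `X`; replies are formulas at states of `A`. Each level of nesting of lists
costs one more factor `X`. The worst case is the list of states, at most `X` trees of size at most
`X ^ 5`. -/
theorem Inv.fits (hA : A.Accepts 𝓛) (h : Inv c T S E k l) {X : ℕ}
    (hX : c.automatonSize A + l + 10 ≤ X) : Fits c T (X ^ 7) S E := by
  have hn := card_le_automatonSize c A
  have hSn := length_le_of_nodup_rows hA h.nodup
  have hlet := sum_letters_le_automatonSize c A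
  have hk := h.asked_le
  have mono : ∀ {i j}, i ≤ j → X ^ i ≤ X ^ j := fun hij => Nat.pow_le_pow_right (by omega) hij
  have ten : ∀ i, 10 * X ^ i ≤ X ^ (i + 1) := fun i => by
    rw [pow_succ']
    gcongr
    omega
  have h1 : 10 * X ^ 1 ≤ X ^ 2 := ten 1
  have h2 : 10 * X ^ 2 ≤ X ^ 3 := ten 2
  have h3 : 10 * X ^ 3 ≤ X ^ 4 := ten 3
  have h4 : 10 * X ^ 4 ≤ X ^ 5 := ten 4
  have h5 : 10 * X ^ 5 ≤ X ^ 6 := ten 5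
  have h6 : 10 * X ^ 6 ≤ X ^ 7 := ten 6
  have hp : X ^ 1 = X := pow_one X
  have hletlen : c.letters.length ≤ X := by
    have : (c.letters.map fun _ => 1).sum ≤ (c.letters.map fun a => (c.letter a).size + 1).sum :=
      List.sum_le_sum fun _ _ => Nat.le_add_left _ _
    simp only [List.map_const', List.sum_replicate, smul_eq_mul, mul_one] at this
    omega
  have hletter : ∀ a, (c.letter a).size ≤ X := fun a => by
    have : (c.letter a).size + 1 ≤ (c.letters.map fun a => (c.letter a).size + 1).sum :=
      List.le_sum_of_mem (List.mem_map_of_mem (f := fun a => (c.letter a).size + 1) (c.complete a))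
    omega
  have hform : ∀ w, (c.formula (T.mem w)).size ≤ X := fun w => by
    rw [hA.mem_eq T]
    have := size_formula_le_automatonSize (A := A) c (A.run w)
    exact this.trans (by omega)
  have hElen : E.length ≤ X ^ 2 := by
    have h1 := h.card
    have : (k + 1) * (l + 1) ≤ X * X := Nat.mul_le_mul (by omega) (by omega)
    have : (k + 1) * (l + 1) = k * l + k + l + 1 := by ring
    rw [pow_two]
    omega
  have hSword : ∀ s ∈ S, (c.word s).size ≤ X ^ 3 := fun s hs =>
    size_word_le (A := A) (by omega) s (by have := h.acc_length s hs; omega)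
  have hSword' : ∀ s ∈ S, ∀ a, (c.word (a :: s)).size ≤ X ^ 3 := fun s hs a =>
    size_word_le (A := A) (by omega) _
      (by have := h.acc_length s hs; simp only [List.length_cons]; omega)
  have hEword : ∀ e ∈ E, (c.word e).size ≤ X ^ 3 := fun s hs =>
    size_word_le (A := A) (by omega) s (by have := h.suf_length s hs; omega)
  have hrow : ∀ u, (rowVal c T E u).size ≤ X ^ 4 := fun u => by
    refine Val.size_ofList_le_pow (a := 2) (b := 1) (by omega) _ (by simpa using hElen) ?_
    intro v hv
    rw [List.mem_reverse] at hv
    obtain ⟨e, -, rfl⟩ := List.mem_map.1 hv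
    rw [hp]
    exact hform _
  have hrows : (Val.ofList (S.map (rowVal c T E)).reverse).size ≤ X ^ 6 := by
    refine Val.size_ofList_le_pow (a := 1) (b := 4) (by omega) _ (by simp; omega) ?_
    intro v hv
    rw [List.mem_reverse] at hv
    obtain ⟨s, -, rfl⟩ := List.mem_map.1 hv
    exact hrow s
  have htrans : ∀ s a, (transVal c T E (S.map (rowVal c T E)).reverse s a).size ≤ X ^ 2 := by
    intro s a
    have h1 := List.idxOf_le_length (l := (S.map (rowVal c T E)).reverse)
      (a := rowVal c T E (a :: s))
    have h2 := hletter a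
    rw [List.length_reverse, List.length_map] at h1
    simp only [transVal, Val.size, Val.size_ofNat]
    omega
  have hstate : ∀ s, (stateVal c T E (S.map (rowVal c T E)).reverse s).size ≤ X ^ 5 := by
    intro s
    have h1 : (rowVal c T E s).head.size ≤ (rowVal c T E s).size := Val.size_head_le _
    have h2 := hrow s
    have h3 : (Val.ofList (c.letters.map
        (transVal c T E (S.map (rowVal c T E)).reverse s))).size ≤ X ^ 4 := by
      refine Val.size_ofList_le_pow (a := 1) (b := 2) (by omega) _ (by simpa using hletlen) ?_
      intro v hv
      obtain ⟨a, -, rfl⟩ := List.mem_map.1 hv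
      exact htrans s a
    simp only [stateVal, Val.size]
    omega
  refine
    { letters := ?_, suf := ?_, acc := ?_, word := ?_, succ := ?_, formula := ?_, row := ?_,
      rows := ?_, length := ?_, states := ?_ }
  · rw [Val.size_ofList_eq, List.map_map]
    change 1 + (c.letters.map fun a => (c.letter a).size + 1).sum ≤ _
    omega
  · refine (Val.size_ofList_le_pow (a := 2) (b := 3) (by omega) _ (by simpa using hElen) ?_).trans
      (mono (by omega))
    intro v hv
    obtain ⟨e, he, rfl⟩ := List.mem_map.1 hv
    exact hEword e he
  · refine (Val.size_ofList_le_pow (a := 1) (b := 3) (by omega) _ (by simp; omega) ?_).trans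
      (mono (by omega))
    intro v hv
    obtain ⟨e, he, rfl⟩ := List.mem_map.1 hv
    exact hSword e he
  · intro s hs a e he
    have := hSword' s hs a
    have := hEword e he
    omega
  · intro s hs a
    exact (hSword' s hs a).trans (mono (by omega))
  · intro w
    have := hform w
    omega
  · intro u
    exact (hrow u).trans (mono (by omega))
  · exact hrows.trans (mono (by omega))
  · rw [Val.size_ofNat]
    omega
  · refine Val.size_ofList_le_pow (a := 1) (b := 5) (by omega) _ (by simp; omega) ?_
    intro v hv
    rw [List.mem_reverse] at hv
    obtain ⟨s, -, rfl⟩ := List.mem_map.1 hv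
    exact hstate s

/-! ### The learning program -/

/-- Poses an equivalence query for the computed automaton and evaluates the reply. -/
def conjectureCmd : Cmd :=
  .seq (.assign 0 (.cons .nil (.var 5))) (.seq (.askEquiv 17 (.var 0))
    (.seq (.assign 18 (.var 17)) (.seq (.assign 17 (.tl (.var 17))) sufLoop)))

/-- One round of the learner. -/
def learnBody : Cmd :=
  .seq tableCmd (.ite (.var 6) (.assign 2 (.cons (.var 6) (.var 2))) conjectureCmd)

/-- The main loop of the learner. -/
def learnLoop : Cmd := .loop (.var 18) learnBody

/-- The learning algorithm. -/
def learner : Cmd :=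
  .seq (.assign 14 (.var 0)) (.seq revLoop (.seq (.assign 1 (.var 13)) (.seq (.assign 13 .nil)
    (.seq (.assign 2 (.cons .nil .nil)) (.seq (.assign 3 (.cons .nil .nil))
      (.seq (.assign 18 (.cons .nil .nil)) learnLoop))))))

/-- The program `P` takes the process from `s` to `s'` within time `N`. -/
def Takes (c : Coding PV F) (T : Teacher 𝓛) (P : Cmd) (s s' : Config) (N : ℕ) : Prop :=
  ∃ t, Exec c T P s s' t ∧ t ≤ N

theorem Takes.mono {P : Cmd} {s s' : Config} {N N' : ℕ} (h : Takes c T P s s' N) (hN : N ≤ N') :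
    Takes c T P s s' N' := by
  obtain ⟨t, h1, h2⟩ := h
  exact ⟨t, h1, h2.trans hN⟩

theorem Takes.seq {P₁ P₂ : Cmd} {s s₁ s₂ : Config} {N₁ N₂ : ℕ} (h₁ : Takes c T P₁ s s₁ N₁)
    (h₂ : Takes c T P₂ s₁ s₂ N₂) : Takes c T (.seq P₁ P₂) s s₂ (N₁ + N₂) := by
  obtain ⟨t₁, a₁, b₁⟩ := h₁
  obtain ⟨t₂, a₂, b₂⟩ := h₂
  exact ⟨_, .seq a₁ a₂, by omega⟩

theorem Takes.ite_false {B : ℕ} (hB : 1 ≤ B) {e : Expr} {P₁ P₂ : Cmd} {s s' : Config} {N : ℕ}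
    (he : e.eval s.store = .nil) (hs : e.Small s.store B) (h : Takes c T P₂ s s' N)
    (hw : e.weight < 18 := by decide) : Takes c T (.ite e P₁ P₂) s s' (20 * B + N) := by
  obtain ⟨t, a, b⟩ := h
  have := Expr.step_cost_le hB e hs hw
  exact ⟨_, .ite_false he a, by omega⟩

theorem Takes.loop_done {B : ℕ} (hB : 1 ≤ B) {e : Expr} {P : Cmd} {s : Config}
    (he : e.eval s.store = .nil) (hs : e.Small s.store B)
    (hw : e.weight < 18 := by decide) : Takes c T (.loop e P) s s (20 * B) := by
  have := Expr.step_cost_le hB e hs hw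
  exact ⟨_, .loop_done he, by omega⟩

theorem Takes.loop_step {B : ℕ} (hB : 1 ≤ B) {e : Expr} {P : Cmd} {s s₁ s₂ : Config}
    {N₁ N₂ : ℕ} (he : e.eval s.store ≠ .nil) (hs : e.Small s.store B)
    (h₁ : Takes c T P s s₁ N₁) (h₂ : Takes c T (.loop e P) s₁ s₂ N₂)
    (hw : e.weight < 18 := by decide) : Takes c T (.loop e P) s s₂ (20 * B + N₁ + N₂) := by
  obtain ⟨t₁, a₁, b₁⟩ := h₁
  obtain ⟨t₂, a₂, b₂⟩ := h₂
  have := Expr.step_cost_le hB e hs hw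
  exact ⟨_, .loop_step he a₁ a₂, by omega⟩

theorem Takes.askEquiv {B : ℕ} (hB : 1 ≤ B) {m : Mem} {x : ℕ} {e : Expr} {H : Conjecture PV F}
    (he : e.eval m.toStore = c.automaton H) (hs : e.Small m.toStore B)
    (hr : (c.reply (T.equiv k H)).size ≤ B)
    (hx : x < 19 := by decide) (hw : e.weight < 18 := by decide) :
    Takes c T (.askEquiv x e) ⟨m.toStore, k, l⟩
      ⟨(m.set x (c.reply (T.equiv k H))).toStore, k + 1,
        max l ((T.equiv k H).getD []).length⟩ (20 * B) := by
  have h := Exec.askEquiv (c := c) (T := T) (s := ⟨m.toStore, k, l⟩) (x := x) he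
  have hl : (T.equiv k H).elim 0 List.length = ((T.equiv k H).getD []).length := by
    cases T.equiv k H <;> rfl
  rw [Config.receive, Mem.update_toStore _ _ _ hx, hl] at h
  have := Expr.step_cost_le hB e hs hw
  refine ⟨_, h, ?_⟩
  simp only
  omega

theorem Run.takes {B : ℕ} {P : Cmd} {m m' : Mem} {N : ℕ} (h : Run c T B P m m' N) (k l : ℕ) :
    Takes c T P ⟨m.toStore, k, l⟩ ⟨m'.toStore, k, l⟩ (N * (20 * B)) := h k l

theorem Takes.assignSeq {B : ℕ} (hB : 1 ≤ B) {m : Mem} {s' : Config} {x : ℕ} {e : Expr} {P : Cmd}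
    {N : ℕ} (hs : e.Small m.toStore B)
    (h : Takes c T P ⟨(m.set x (e.eval m.toStore)).toStore, k, l⟩ s' N)
    (hx : x < 19 := by decide) (hw : e.weight < 18 := by decide) :
    Takes c T (.seq (.assign x e) P) ⟨m.toStore, k, l⟩ s' (20 * B + N) := by
  have := ((Run.assign (c := c) (T := T) hB x e hs rfl hx hw).takes k l).seq h
  rwa [Nat.one_mul] at this

theorem Takes.learnLoop_step {B : ℕ} (hB : 1 ≤ B) {s s₁ s₂ : Config} {N₁ N₂ : ℕ}
    (h₁ : Takes c T learnBody s s₁ N₁) (h₂ : Takes c T learnLoop s₁ s₂ N₂)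
    (hgo : s.store 18 ≠ .nil) (hs : (s.store 18).size ≤ B) :
    Takes c T learnLoop s s₂ (20 * B + N₁ + N₂) :=
  Takes.loop_step hB (e := .var 18) hgo hs h₁ h₂

/-- The memory at the beginning of a round. -/
def loopMem (c : Coding PV F) (S E : List (SymWord PV Y)) (out rows states new go : Val) : Mem :=
  { out := out, sig := .ofList (c.letters.map c.letter).reverse, acc := .ofList (S.map c.word),
    suf := .ofList (E.map c.word), rows := rows, states := states, go := go, new := new }

/-- The reply "yes" is treated like the empty counterexample: the tail of `nil` is `nil`, the code
of the empty word, which adds no suffixes. The reply itself is kept in `go`, where `nil` ends the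
main loop. -/
theorem takes_conjectureCmd {B : ℕ} (hB : 1 ≤ B) {out rows states new go : Val}
    {H : Conjecture PV F} (hst : .cons .nil states = c.automaton H)
    (hstB : states.size + 2 ≤ B) (hr : (c.reply (T.equiv k H)).size ≤ B)
    (hE : (Val.ofList ((addSuffixes ((T.equiv k H).getD []) E).map c.word)).size ≤ B) :
    Takes c T conjectureCmd ⟨(loopMem c S E out rows states new go).toStore, k, l⟩
      ⟨(loopMem c S (addSuffixes ((T.equiv k H).getD []) E) (c.automaton H) rows states new
        (c.reply (T.equiv k H))).toStore, k + 1, max l ((T.equiv k H).getD []).length⟩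
      ((3 * B + 4) * (20 * B)) := by
  have hstB' : states.size ≤ B := by omega
  have haut : (c.automaton H).size ≤ B := by
    rw [← hst]; simp only [Val.size]; omega
  have hw : (c.word ((T.equiv k H).getD [])).size ≤ B := by
    cases h : T.equiv k H with
    | none => exact hB
    | some w =>
      rw [h] at hr
      simp only [Coding.reply, Val.size] at hr
      simp only [Option.getD_some]; omega
  have htail : (match c.reply (T.equiv k H) with | .nil => Val.nil | .cons _ y => y) =
      c.word ((T.equiv k H).getD []) := by
    cases T.equiv k H <;> rfl
  have h1 : Run c T B (.assign 0 (.cons .nil (.var 5))) (loopMem c S E out rows states new go)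
      (loopMem c S E (c.automaton H) rows states new go) 1 :=
    Run.assign hB _ _ (And.intro trivial hstB') (by rw [← hst]; rfl)
  have h2 : Takes c T (.askEquiv 17 (.var 0))
      ⟨(loopMem c S E (c.automaton H) rows states new go).toStore, k, l⟩ _ _ :=
    Takes.askEquiv (l := l) hB rfl haut hr
  have h3 : Run c T B (.seq (.assign 18 (.var 17)) (.seq (.assign 17 (.tl (.var 17))) sufLoop))
      ((loopMem c S E (c.automaton H) rows states new go).set 17 (c.reply (T.equiv k H)))
      (loopMem c S (addSuffixes ((T.equiv k H).getD []) E) (c.automaton H) rows states new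
        (c.reply (T.equiv k H))) (1 + (1 + 3 * B)) := by
    refine Run.assignSeq hB hr <| Run.seq (Run.assign hB 17 _ hr (m' :=
      { loopMem c S E (c.automaton H) rows states new (c.reply (T.equiv k H)) with
        w := c.word ((T.equiv k H).getD []) }) ?_) ?_
    · rw [← htail]; rfl
    · exact run_sufLoop hB (loopMem c S E (c.automaton H) rows states new
        (c.reply (T.equiv k H))) _ E hw hE
  refine ((h1.takes k l).seq (h2.seq (h3.takes _ _))).mono (le_of_eq ?_)
  ring

/-- With `B = X ^ 8`, the table takes at most `B ^ 5` units of `20 * B`, and the total is at most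
`40 * B ^ 6`, so at most `B ^ 7`. -/
theorem round_time_le {X : ℕ} (hX : 10 ≤ X) :
    (tableTime (X ^ 8) + 3 * X ^ 8 + 10) * (20 * X ^ 8) ≤ X ^ 56 := by
  have hB : 100 ≤ X ^ 8 := by
    calc 100 ≤ 10 ^ 8 := by norm_num
      _ ≤ X ^ 8 := by gcongr
  have h1 := tableTime_le hB
  have h3 : 100 * X ^ 8 ≤ (X ^ 8) ^ 2 := by simpa using hundred_mul_pow_le hB 1
  have h4 : 100 * (X ^ 8) ^ 2 ≤ (X ^ 8) ^ 3 := hundred_mul_pow_le hB 2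
  have h5 : 100 * (X ^ 8) ^ 3 ≤ (X ^ 8) ^ 4 := hundred_mul_pow_le hB 3
  have h6 : 100 * (X ^ 8) ^ 4 ≤ (X ^ 8) ^ 5 := hundred_mul_pow_le hB 4
  have h7 : 100 * (X ^ 8) ^ 5 ≤ (X ^ 8) ^ 6 := hundred_mul_pow_le hB 5
  calc (tableTime (X ^ 8) + 3 * X ^ 8 + 10) * (20 * X ^ 8)
      ≤ (2 * (X ^ 8) ^ 5) * (20 * X ^ 8) := by gcongr; omega
    _ = 40 * (X ^ 8) ^ 6 := by ring
    _ ≤ X ^ 8 * (X ^ 8) ^ 6 := by gcongr; omega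
    _ = X ^ 56 := by ring

theorem Inv.ne_nil (h : Inv c T S E k l) : E ≠ [] := by
  obtain ⟨E₀, rfl⟩ := h.suf_last
  simp

theorem takes_learnBody_of_closed (hA : A.Accepts 𝓛) (h : Inv c T S E k l)
    (hcl : Closed c T S E) (out rows states new go : Val) {H : Conjecture PV F}
    (hH : H = ⟨S.length, hypothesis h.length_pos hcl⟩) {X : ℕ}
    (hX : c.automatonSize A + max l ((T.equiv k H).getD []).length + 10 ≤ X) :
    ∃ rows' states' new',
      Takes c T learnBody ⟨(loopMem c S E out rows states new go).toStore, k, l⟩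
        ⟨(loopMem c S (addSuffixes ((T.equiv k H).getD []) E) (c.automaton H) rows' states' new'
          (c.reply (T.equiv k H))).toStore, k + 1, max l ((T.equiv k H).getD []).length⟩
        (X ^ 56) := by
  have hl1 := le_max_left l ((T.equiv k H).getD []).length
  have hl2 := le_max_right l ((T.equiv k H).getD []).length
  have hX1 : 1 ≤ X ^ 8 := Nat.one_le_pow _ _ (by omega)
  have h78 : 10 * X ^ 7 ≤ X ^ 8 := by rw [pow_succ' X 7]; gcongr; omega
  have h17 : X ^ 1 ≤ X ^ 7 := Nat.pow_le_pow_right (by omega) (by omega)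
  have h37 : X ^ 3 ≤ X ^ 7 := Nat.pow_le_pow_right (by omega) (by omega)
  rw [pow_one] at h17
  have hfit := h.fits hA (X := X) (by omega)
  obtain ⟨nw, h1, h2⟩ := run_tableCmd hX1 h.ne_nil
    (hfit.mono (by omega)) { out := out, rows := rows, states := states, new := new, go := go }
  have hnw : nw = .nil := by
    rcases h2 with h2 | ⟨s, hs, a, -, ha⟩
    · exact h2.1
    · exact absurd (hcl s hs a) ha
  subst hnw
  have hst := hfit.states
  have hword := size_word_le (c := c) (A := A) (X := X) (by omega) ((T.equiv k H).getD [])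
    (by omega)
  -- After a counterexample, the enlarged table satisfies the invariant again, with the new maximal
  -- length; `X` was chosen to cover that length.
  have hE : (Val.ofList ((addSuffixes ((T.equiv k H).getD []) E).map c.word)).size ≤ X ^ 7 := by
    cases hr : T.equiv k H with
    | none => exact hfit.suf
    | some w =>
      have hw := T.equiv_counterexample k H w hr
      subst hH
      rw [hr] at hX
      exact ((h.addSuffixes hcl hw).fits hA hX).suf
  have h3 := takes_conjectureCmd (c := c) (T := T) (S := S) (E := E) (k := k) (l := l)
    (B := X ^ 8) hX1 (out := out) (new := .nil) (rows := .ofList (S.map (rowVal c T E)).reverse)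
    (go := go) (H := H)
    (states := .ofList (S.map (stateVal c T E (S.map (rowVal c T E)).reverse)).reverse)
    (by rw [hH, automaton_hypothesis h.length_pos hcl h.suf_last]) (by omega) (by
      cases hr : T.equiv k H with
      | none => exact hX1
      | some w =>
        rw [hr, Option.getD_some] at hword
        simp only [Coding.reply, Val.size]
        omega) (by omega)
  have h4 : Takes c T (.ite (.var 6) (.assign 2 (.cons (.var 6) (.var 2))) conjectureCmd)
      ⟨(loopMem c S E out (.ofList (S.map (rowVal c T E)).reverse) (.ofList (S.map (stateVal c T E
        (S.map (rowVal c T E)).reverse)).reverse) .nil go).toStore, k, l⟩ _ _ :=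
    Takes.ite_false hX1 rfl hX1 h3
  refine ⟨_, _, _, ((h1.takes k l).seq h4).mono ?_⟩
  refine le_trans (le_of_eq ?_) ((Nat.mul_le_mul_right (20 * X ^ 8)
    (show tableTime (X ^ 8) + 3 * X ^ 8 + 5 ≤ tableTime (X ^ 8) + 3 * X ^ 8 + 10 by omega)).trans
    (round_time_le (X := X) (by omega)))
  ring

theorem takes_learnBody_of_not_closed (hA : A.Accepts 𝓛) (h : Inv c T S E k l)
    (hcl : ¬ Closed c T S E) (out rows states new go : Val) {X : ℕ}
    (hX : c.automatonSize A + l + 10 ≤ X) :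
    ∃ u rows' states' new', Inv c T (u :: S) E k l ∧
      Takes c T learnBody ⟨(loopMem c S E out rows states new go).toStore, k, l⟩
        ⟨(loopMem c (u :: S) E out rows' states' new' go).toStore, k, l⟩ (X ^ 56) := by
  have hX1 : 1 ≤ X ^ 8 := Nat.one_le_pow _ _ (by omega)
  have hfit := (h.fits hA hX).mono (Nat.pow_le_pow_right (by omega) (by omega) : X ^ 7 ≤ X ^ 8)
  obtain ⟨nw, h1, h2⟩ := run_tableCmd hX1 h.ne_nil hfit
    { out := out, rows := rows, states := states, new := new, go := go }
  rcases h2 with h2 | ⟨s, hs, a, rfl, ha⟩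
  · exact absurd h2.2 hcl
  · refine ⟨a :: s, .ofList (S.map (rowVal c T E)).reverse, .ofList (S.map (stateVal c T E
      (S.map (rowVal c T E)).reverse)).reverse, c.word (a :: s), h.addAccess hs ha, ?_⟩
    have hu := hfit.succ s hs a
    have h3 : Run c T (X ^ 8) (.ite (.var 6) (.assign 2 (.cons (.var 6) (.var 2))) conjectureCmd)
        (loopMem c S E out (.ofList (S.map (rowVal c T E)).reverse) (.ofList (S.map (stateVal c T E
          (S.map (rowVal c T E)).reverse)).reverse) (c.word (a :: s)) go)
        (loopMem c ((a :: s) :: S) E out (.ofList (S.map (rowVal c T E)).reverse)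
          (.ofList (S.map (stateVal c T E (S.map (rowVal c T E)).reverse)).reverse)
          (c.word (a :: s)) go) (1 + 1) :=
      Run.ite_true hX1 Val.noConfusion hu (Run.assign hX1 _ _ (And.intro hu hfit.acc) rfl)
    exact ((h1.seq h3).takes k l).mono ((Nat.mul_le_mul_right _ (by omega)).trans
      (round_time_le (X := X) (by omega)))

/-- `N` is fuel: a round that does not end the loop raises `S.length + k` by one, by an access word
or by a refuted conjecture. Both summands are at most `n`, so the fuel cannot run out. The time
refers to the final `l'`, which dominates the lengths at all earlier rounds. -/
theorem takes_learnLoop (hA : A.Accepts 𝓛) (N : ℕ) (h : Inv c T S E k l)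
    (out rows states new go : Val) (hgo : go ≠ .nil)
    (hgoB : go.size ≤ (c.automatonSize A + l + 10) ^ 8) (hN : 2 * n + 1 ≤ N + S.length + k) :
    ∃ (m' : Mem) (k' l' ν : ℕ) (H : QDA PV F (Fin ν)), H.Accepts 𝓛 ∧ ν ≤ n ∧ l ≤ l' ∧
      m'.out = c.automaton ⟨ν, H⟩ ∧
      Takes c T learnLoop ⟨(loopMem c S E out rows states new go).toStore, k, l⟩
        ⟨m'.toStore, k', l'⟩ ((N + 1) * (c.automatonSize A + l' + 10) ^ 57) := by
  have loop_time : ∀ X : ℕ, 10 ≤ X → 20 * X ^ 8 + X ^ 56 ≤ X ^ 57 := by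
    intro X hX
    have h1 : 10 * X ^ 56 ≤ X ^ 57 := by rw [pow_succ' X 56]; gcongr
    have h2 : 10 * X ^ 8 ≤ X ^ 9 := by rw [pow_succ' X 8]; gcongr
    have h3 : X ^ 9 ≤ X ^ 56 := Nat.pow_le_pow_right (by omega) (by omega)
    omega
  induction N generalizing S E k l out rows states new go with
  | zero =>
    have h1 := length_le_of_nodup_rows hA h.nodup
    have h2 := h.asked_le
    omega
  | succ N ih =>
    by_cases hcl : Closed c T S E
    · obtain ⟨H, hH⟩ : ∃ H : Conjecture PV F, H = ⟨S.length, hypothesis h.length_pos hcl⟩ :=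
        ⟨_, rfl⟩
      obtain ⟨rows', states', new', h1⟩ := takes_learnBody_of_closed hA h hcl out rows states new
        go hH le_rfl
      set l₁ := max l ((T.equiv k H).getD []).length with hl₁
      have hll : l ≤ l₁ := le_max_left _ _
      have hX1 : 1 ≤ (c.automatonSize A + l₁ + 10) ^ 8 := Nat.one_le_pow _ _ (by omega)
      have hgoB' : go.size ≤ (c.automatonSize A + l₁ + 10) ^ 8 :=
        hgoB.trans (Nat.pow_le_pow_left (by omega) _)
      have hlt := loop_time (c.automatonSize A + l₁ + 10) (by omega)
      cases hr : T.equiv k H with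
      | none =>
        rw [hr] at h1
        have hacc := (T.equiv_yes k H).1 hr
        have h2 := Takes.learnLoop_step hX1 h1 (Takes.loop_done (e := .var 18) hX1 rfl hX1) hgo
          hgoB'
        refine ⟨_, _, l₁, H.1, H.2, hacc, ?_, hll, rfl, h2.mono ?_⟩
        · rw [hH]
          exact length_le_of_nodup_rows hA h.nodup
        · have : (0 + 1 + 1) * (c.automatonSize A + l₁ + 10) ^ 57 ≤
              (N + 1 + 1) * (c.automatonSize A + l₁ + 10) ^ 57 := by gcongr; omega
          omega
      | some w =>
        have hw := T.equiv_counterexample k H w hr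
        have hinv : Inv c T S (addSuffixes w E) (k + 1) l₁ := by
          rw [hl₁, hr]
          subst hH
          exact h.addSuffixes hcl hw
        rw [hr] at h1
        have hwl : w.length ≤ l₁ := by rw [hl₁, hr]; exact le_max_right _ _
        have hword := size_word_le (c := c) (A := A) (X := c.automatonSize A + l₁ + 10) (by omega)
          w (by omega)
        obtain ⟨m', k', l', ν, H', a1, a2, a3, a4, a5⟩ := ih hinv (c.automaton H) rows' states' new'
          (c.reply (some w)) Val.noConfusion (by
            have h2 : 10 * (c.automatonSize A + l₁ + 10) ^ 7 ≤
                (c.automatonSize A + l₁ + 10) ^ 8 := by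
              rw [pow_succ' _ 7]; gcongr; omega
            have h3 : (c.automatonSize A + l₁ + 10) ^ 3 ≤ (c.automatonSize A + l₁ + 10) ^ 7 :=
              Nat.pow_le_pow_right (by omega) (by omega)
            have h4 : 1 ≤ (c.automatonSize A + l₁ + 10) ^ 7 := Nat.one_le_pow _ _ (by omega)
            simp only [Coding.reply, Val.size]
            omega) (by omega)
        refine ⟨m', k', l', ν, H', a1, a2, hll.trans a3, a4,
          (Takes.learnLoop_step hX1 h1 a5 hgo hgoB').mono ?_⟩
        have h5 : (c.automatonSize A + l₁ + 10) ^ 57 ≤ (c.automatonSize A + l' + 10) ^ 57 := by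
          gcongr
        rw [Nat.add_mul (N + 1)]
        omega
    · obtain ⟨u, rows', states', new', hinv, h1⟩ := takes_learnBody_of_not_closed hA h hcl out rows
        states new go le_rfl
      have hX1 : 1 ≤ (c.automatonSize A + l + 10) ^ 8 := Nat.one_le_pow _ _ (by omega)
      have hlt := loop_time (c.automatonSize A + l + 10) (by omega)
      obtain ⟨m', k', l', ν, H', a1, a2, a3, a4, a5⟩ := ih hinv out rows' states' new'
        go hgo hgoB (by simp only [List.length_cons]; omega)
      refine ⟨m', k', l', ν, H', a1, a2, a3, a4, (Takes.learnLoop_step hX1 h1 a5 hgo hgoB).mono ?_⟩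
      have h5 : (c.automatonSize A + l + 10) ^ 57 ≤ (c.automatonSize A + l' + 10) ^ 57 := by
        gcongr
      rw [Nat.add_mul (N + 1)]
      omega

theorem takes_learner (hA : A.Accepts 𝓛) (c : Coding PV F) (T : Teacher 𝓛) :
    ∃ (m' : Mem) (k' l' ν : ℕ) (H : QDA PV F (Fin ν)), H.Accepts 𝓛 ∧ ν ≤ n ∧
      m'.out = c.automaton ⟨ν, H⟩ ∧
      Takes c T learner c.initial ⟨m'.toStore, k', l'⟩ ((c.automatonSize A + l' + 10) ^ 59) := by
  obtain ⟨X, hX⟩ : ∃ X, X = c.automatonSize A + 0 + 10 := ⟨_, rfl⟩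
  have hX1 : 1 ≤ X ^ 8 := Nat.one_le_pow _ _ (by omega)
  have hX18 : X ^ 1 ≤ X ^ 8 := Nat.pow_le_pow_right (by omega) (by omega)
  have hX28 : X ^ 2 ≤ X ^ 8 := Nat.pow_le_pow_right (by omega) (by omega)
  have hX2 : 10 * X ≤ X ^ 2 := by rw [pow_two]; gcongr; omega
  have hlet : (Val.ofList (c.letters.map c.letter)).size ≤ X := by
    have := sum_letters_le_automatonSize c A
    rw [Val.size_ofList_eq, List.map_map]
    change 1 + (c.letters.map fun a => (c.letter a).size + 1).sum ≤ _
    omega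
  have hlen : c.letters.length ≤ X := by
    have := Val.length_le_size_ofList (c.letters.map c.letter)
    rw [List.length_map] at this
    omega
  rw [pow_one] at hX18
  have hlet8 := hlet.trans hX18
  have h0 : c.initial =
      ⟨({ out := .ofList (c.letters.map c.letter) } : Mem).toStore, 0, 0⟩ := by
    have : (fun _ => Val.nil) = ({} : Mem).toStore := by
      funext i
      unfold Mem.toStore
      split <;> rfl
    rw [Coding.initial, this, Mem.update_toStore _ _ _ (by omega)]
    rfl
  have hrev := run_revLoop (c := c) (T := T) hX1 { out := .ofList (c.letters.map c.letter) }
    (c.letters.map c.letter) [] (by simp only [Val.ofList, Val.size] at *; omega)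
  rw [List.append_nil] at hrev
  have hlet' : (Val.ofList (c.letters.map c.letter).reverse).size ≤ X ^ 8 := by
    rwa [Val.size_ofList_reverse]
  -- Initially `S.length + k = 1`, so `2 * n` is enough fuel. The tree `cons nil nil` is both the
  -- list containing only the empty word and the truth value that starts the loop.
  obtain ⟨m', k', l', ν, H, a1, a2, a3, a4, a5⟩ := takes_learnLoop hA (2 * n)
    (Inv.init (c := c) (T := T)) (.ofList (c.letters.map c.letter)) .nil .nil .nil
    (.cons .nil .nil) Val.noConfusion (by rw [← hX]; simp only [Val.size]; omega) (by simp)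
  refine ⟨m', k', l', ν, H, a1, a2, a4, ?_⟩
  rw [h0]
  have h1 := Takes.assignSeq (c := c) (T := T) (k := 0) (l := 0) (x := 14) (e := .var 0)
    (m := { out := .ofList (c.letters.map c.letter) }) hX1 hlet8 <| (hrev.takes 0 0).seq <|
    Takes.assignSeq (x := 1) (e := .var 13) hX1 hlet' <|
    Takes.assignSeq (x := 13) (e := .nil) hX1 trivial <|
    Takes.assignSeq (x := 2) (e := .cons .nil .nil) hX1 (And.intro trivial trivial) <|
    Takes.assignSeq (x := 3) (e := .cons .nil .nil) hX1 (And.intro trivial trivial) <|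
    Takes.assignSeq (x := 18) (e := .cons .nil .nil) hX1 (And.intro trivial trivial) a5
  refine h1.mono ?_
  obtain ⟨Z, hZ⟩ : ∃ Z, Z = c.automatonSize A + l' + 10 := ⟨_, rfl⟩
  have hn := card_le_automatonSize c A
  have hXZ : X ^ 8 ≤ Z ^ 8 := Nat.pow_le_pow_left (by omega) _
  have hrevtime : (3 * (c.letters.map c.letter).length + 1) * (20 * X ^ 8) ≤
      (4 * Z) * (20 * Z ^ 8) := by
    gcongr
    rw [List.length_map]
    omega
  have hrevtime' : (4 * Z) * (20 * Z ^ 8) = 80 * Z ^ 9 := by ring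
  have hloop : (2 * n + 1) * Z ^ 57 ≤ (2 * Z) * Z ^ 57 := by gcongr; omega
  have hloop' : (2 * Z) * Z ^ 57 = 2 * Z ^ 58 := by ring
  have h9 : 10 * Z ^ 8 ≤ Z ^ 9 := by rw [pow_succ' Z 8]; gcongr; omega
  have h10 : 10 * Z ^ 9 ≤ Z ^ 10 := by rw [pow_succ' Z 9]; gcongr; omega
  have h58 : Z ^ 10 ≤ Z ^ 57 := Nat.pow_le_pow_right (by omega) (by omega)
  have h59 : 10 * Z ^ 57 ≤ Z ^ 58 := by rw [pow_succ' Z 57]; gcongr; omega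
  have h60 : 10 * Z ^ 58 ≤ Z ^ 59 := by rw [pow_succ' Z 58]; gcongr; omega
  rw [← hZ]
  omega

end

end QDALearning

theorem theorem2 :
    ∃ (P : QDALearning.Cmd) (p : MvPolynomial (Fin 2) ℕ),
      ∀ (L : FirstOrder.Language) (D : Type*) [L.Structure D] (PV Y : Type*) [Finite PV] [Finite Y]
        (F : QDALearning.FormulaLattice L D Y) (𝓛 : Set (QDALearning.FormulaWord PV F)),
        QDALearning.QDAAcceptable PV F 𝓛 →
        ∃ (n : ℕ) (A : QDALearning.QDA PV F (Fin n)),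
          A.IsMinimalFor 𝓛 ∧
          (∀ (Q : Type) (B : QDALearning.QDA PV F Q), B.IsMinimalFor 𝓛 → A.Isomorphic B) ∧
          ∀ (c : QDALearning.Coding PV F) (T : QDALearning.Teacher 𝓛),
            ∃ (A' : QDALearning.QDA PV F (Fin n)) (s : QDALearning.Config) (t : ℕ),
              QDALearning.Exec c T P c.initial s t ∧
              s.store 0 = c.automaton ⟨n, A'⟩ ∧
              A'.IsMinimalFor 𝓛 ∧ A'.Isomorphic A ∧
              t ≤ MvPolynomial.eval ![c.automatonSize A, s.longest] p := by
  refine ⟨QDALearning.learner, (MvPolynomial.X 0 + MvPolynomial.X 1 + MvPolynomial.C 10) ^ 59, ?_⟩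
  intro L D _ PV Y _ _ F 𝓛 h𝓛
  obtain ⟨n, A, hred, hA⟩ := QDALearning.exists_isReduced h𝓛
  have hmin := hred.isMinimalFor hA
  refine ⟨n, A, hmin, fun Q B hB => hred.isomorphic hA hB, fun c T => ?_⟩
  obtain ⟨m', k', l', ν, H, hH, hν, hout, t, hexec, ht⟩ := QDALearning.takes_learner hA c T
  -- The confirmed conjecture has at most `n` states, and minimality of `A` gives the reverse
  -- inequality; so it is minimal itself.
  obtain rfl : ν = n := by
    have := hmin.2.2 (Fin ν) H hH
    simp only [Nat.card_eq_fintype_card, Fintype.card_fin] at this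
    omega
  have hHmin : H.IsMinimalFor 𝓛 := ⟨inferInstance, hH, hmin.2.2⟩
  obtain ⟨e, he₁, he₂, he₃⟩ := hred.isomorphic hA hHmin
  refine ⟨H, _, t, hexec, hout, hHmin, ⟨e.symm, ?_, fun q a => ?_, fun q => ?_⟩, ?_⟩
  · rw [← he₁, Equiv.symm_apply_apply]
  · rw [Equiv.symm_apply_eq, he₂, Equiv.apply_symm_apply]
  · rw [he₃, Equiv.apply_symm_apply]
  · simpa using ht
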